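/- **Theorem 2.** Let $d=2^n$. There are universal constants $C,c>0$ such that the following holds for every $n$, every $n$-qubit density matrix $\rho$, every $K\ge 1$, all distinct off-diagonal positions $(j_1,k_1),\dots,(j_K,k_K)$ (with $j_t\neq k_t$), every $\epsilon>0$ and every $\delta\in(0,1)$. Put $L=\log(2K/\delta)$ and $$|\phi_{jk}\rangle=\tfrac{1}{\sqrt2}(|j\rangle+|k\rangle),\qquad |\psi_{jk}\rangle=\tfrac{1}{\sqrt2}(|j\rangle+i|k\rangle).$$ 1. (Reconstruction.) For every $t$, with $(j,k)=(j_t,k_t)$, $$\rho_{jk}=\operatorname{tr}(\rho|\phi_{jk}\rangle\langle\phi_{jk}|)-i\operatorname{tr}(\rho|\psi_{jk}\rangle\langle\psi_{jk}|)-\tfrac{1-i}{2}(\rho_{jj}+\rho_{kk}).$$ 2. (Diagonal entries.) If $N\ge C L/\epsilon^2$ independent copies of $\rho$ are measured in the computational basis, then with probability at least $1-\delta$ the relative frequencies of the outcomes $j_t,k_t$ are within $\epsilon$ of $\rho_{j_tj_t},\rho_{k_tk_t}$ for all $t$ simultaneously. 3. (Projectors.) Consider either of the following classical shadow protocols, in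 which one copy of $\rho$ is used by drawing a random unitary $U$, measuring $U\rho U^\dagger$ in the computational basis with outcome $b$, and recording the snapshot $\mathcal M^{-1}(U^\dagger|b\rangle\langle b|U)$: * random Clifford: $U$ is uniform over the $n$-qubit Clifford group modulo global phases, and $\mathcal M^{-1}(X)=(2^n+1)X-\operatorname{tr}(X)I$; * biased MUB: for any complete set of mutually unbiased bases $\mathcal B_j=\{U_j^\dagger|k\rangle\}_k$, $0\le j\le 2^n$, with $\mathcal B_0$ the computational basis ($U_0=I$), $U=U_j$ is drawn with probability $\frac12$ for $j=0$ and $\frac1{2^{n+1}}$ for each $j\ge1$, and $\mathcal M^{-1}(X)=2^{n+1}\bigl[X-\frac{2^n-1}{2^n}\sum_k\langle k|X|k\rangle\,|k\rangle\langle k|\bigr]-\frac{\operatorname{tr}(X)}{2^n}I$. For an observable $O$, the numbers $\operatorname{tr}(O\hat\rho_i)$, where $\hat\rho_1,\dots,\hat\rho_N$ are the snapshots from $N$ independent copies, are split into $B=\lceil cL\rceil$ batches of size $\lfloor N/B\rfloor$ (leftovers dropped), and the estimate of $\operatorname{tr}(\rho O)$ is the median of the batch means. If $N\ge CL/\epsilon^2$,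 then with probability at least $1-\delta$ these estimates are within $\epsilon$ of $\operatorname{tr}(\rho O)$ simultaneously for all the observables $O=|\phi_{j_tk_t}\rangle\langle\phi_{j_tk_t}|$ and $O=|\psi_{j_tk_t}\rangle\langle\psi_{j_tk_t}|$, $t=1,\dots,K$. 4. (Off-diagonal entries.) If $N_1\ge CL/\epsilon^2$ copies are used as in 2 and $N_2\ge CL/\epsilon^2$ further independent copies as in 3 (with either protocol), and $\tilde\rho_{j_tk_t}$ is obtained by inserting the estimates into the formula of 1, then with probability at least $1-\delta$ $$|\tilde\rho_{j_tk_t}-\rho_{j_tk_t}|\le\epsilon\quad\text{for all }t=1,\dots,K.$$ In particular, for fixed $\delta$ and $K\ge2$, each step needs $O(\log K/\epsilon^2)$ samples as $\epsilon\to0$, with a constant independent of $n$. -/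

import Mathlib

open scoped ComplexOrder

noncomputable section

/-! ### States and measurement in the computational basis -/

/-- A density matrix (quantum state) on a system whose computational basis is indexed by `ι`. -/
structure DensityMatrix (ι : Type) [Fintype ι] where
  mat : Matrix ι ι ℂ
  posSemidef : mat.PosSemidef
  trace_eq_one : mat.trace = 1

open scoped MatrixOrder Matrix.Norms.L2Operator in
/-- Evolution of a state under a star-automorphism of the matrix algebra; for
`Unitary.conjStarAlgAut ℂ _ U` this is `ρ ↦ U ρ U†`. -/
def DensityMatrix.evolve {ι : Type} [Fintype ι] [DecidableEq ι] (ρ : DensityMatrix ι)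
    (α : Matrix ι ι ℂ ≃⋆ₐ[ℂ] Matrix ι ι ℂ) : DensityMatrix ι where
  mat := α ρ.mat
  posSemidef := by
    obtain ⟨B, hB⟩ := CStarAlgebra.nonneg_iff_eq_star_mul_self.1 ρ.posSemidef.nonneg
    rw [hB, map_mul, map_star]
    exact Matrix.posSemidef_conjTranspose_mul_self (α B)
  trace_eq_one := by
    rw [← ρ.trace_eq_one]
    exact Matrix.trace_map α.toAlgEquiv ρ.mat

/-- Born rule: the law of the outcome of measuring `ρ` in the computational basis. -/
def DensityMatrix.measure {ι : Type} [Fintype ι] (ρ : DensityMatrix ι) : PMF ι :=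
  PMF.ofFintype (fun j => ENNReal.ofReal (ρ.mat j j).re) (by
    rw [← ENNReal.ofReal_sum_of_nonneg
      (fun j _ => (Complex.nonneg_iff.1 (ρ.posSemidef.diag_nonneg (i := j))).1)]
    have h := congrArg Complex.re ρ.trace_eq_one
    simp only [Matrix.trace, Matrix.diag, Complex.re_sum, Complex.one_re] at h
    rw [h, ENNReal.ofReal_one])

/-- The law of `N` independent samples from `p`. -/
def iidPMF {α : Type} [Fintype α] (p : PMF α) (N : ℕ) : PMF (Fin N → α) :=
  PMF.ofFintype (fun ω => ∏ i, p (ω i)) (by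
    classical
    have h : ∑ a, p a = 1 := by rw [← tsum_fintype (L := .unconditional α)]; exact p.tsum_coe
    have := Finset.prod_univ_sum (fun _ : Fin N => (Finset.univ : Finset α)) (fun _ a => p a)
    rw [Fintype.piFinset_univ] at this
    rw [← this]
    simp [h])

/-- The joint law of two independent samples, from `p` and from `q`. -/
def prodPMF {α β : Type} (p : PMF α) (q : PMF β) : PMF (α × β) :=
  p.bind fun x => q.map (Prod.mk x)

/-- The relative frequency of the outcome `j` among `N` outcomes. -/
def relFreq {ι : Type} [DecidableEq ι] {N : ℕ} (x : Fin N → ι) (j : ι) : ℝ :=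
  ((Finset.univ.filter fun i => x i = j).card : ℝ) / N

/-! ### The observables -/

/-- `|v⟩⟨v|`. -/
def ketBra {ι : Type} (v : ι → ℂ) : Matrix ι ι ℂ := Matrix.vecMulVec v (star v)

/-- The computational basis vector `|j⟩`. -/
def ket {ι : Type} [DecidableEq ι] (j : ι) : ι → ℂ := Pi.single j 1

/-- `|φ_jk⟩ = (|j⟩ + |k⟩) / √2`. -/
def phiKet {ι : Type} [DecidableEq ι] (j k : ι) : ι → ℂ :=
  ((Real.sqrt 2 : ℝ) : ℂ)⁻¹ • (ket j + ket k)

/-- `|ψ_jk⟩ = (|j⟩ + i|k⟩) / √2`. -/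
def psiKet {ι : Type} [DecidableEq ι] (j k : ι) : ι → ℂ :=
  ((Real.sqrt 2 : ℝ) : ℂ)⁻¹ • (ket j + Complex.I • ket k)

/-- The linear combination that turns the two projector expectations `φ`, `ψ` and the two diagonal
entries `p`, `q` into an off-diagonal entry. -/
def recombine (φ ψ p q : ℂ) : ℂ := φ - Complex.I * ψ - (1 - Complex.I) / 2 * (p + q)

/-! ### Median of means -/

/-- The median of `B` real numbers (the mean of the two middle ones when `B` is even). -/
def median {B : ℕ} (y : Fin B → ℝ) : ℝ :=
  if h : 0 < B then
    (y (Tuple.sort y ⟨(B - 1) / 2, by omega⟩) + y (Tuple.sort y ⟨B / 2, by omega⟩)) / 2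
  else 0

/-- The median of the means of `B` consecutive batches of `⌊N / B⌋` numbers each. -/
def medianOfMeans (B : ℕ) {N : ℕ} (x : Fin N → ℝ) : ℝ :=
  median fun k : Fin B =>
    (∑ i ∈ Finset.univ.filter (fun i : Fin N => (i : ℕ) / (N / B) = (k : ℕ)), x i) / (N / B : ℕ)

/-! ### Classical shadows -/

/-- A classical shadow protocol: draw a setting `s` from `law`, evolve the state by the conjugation
`evol s` (that is, `X ↦ U_s X U_s†`), measure in the computational basis, and apply `invChannel` to
the resulting snapshot `U_s† |b⟩⟨b| U_s`. -/
structure ShadowProtocol (ι : Type) [Fintype ι] where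
  Setting : Type
  [fintypeSetting : Fintype Setting]
  law : PMF Setting
  evol : Setting → (Matrix ι ι ℂ ≃⋆ₐ[ℂ] Matrix ι ι ℂ)
  invChannel : Matrix ι ι ℂ → Matrix ι ι ℂ

attribute [instance] ShadowProtocol.fintypeSetting

/-- The law of the record (setting, outcome) of one use of the protocol on the state `ρ`. -/
def ShadowProtocol.shot {ι : Type} [Fintype ι] [DecidableEq ι] (S : ShadowProtocol ι)
    (ρ : DensityMatrix ι) : PMF (S.Setting × ι) :=
  S.law.bind fun s => ((ρ.evolve (S.evol s)).measure).map (Prod.mk s)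

/-- The classical snapshot `M⁻¹(U_s† |b⟩⟨b| U_s)` of a record `(s, b)`. -/
def ShadowProtocol.snapshot {ι : Type} [Fintype ι] [DecidableEq ι] (S : ShadowProtocol ι)
    (r : S.Setting × ι) : Matrix ι ι ℂ :=
  S.invChannel ((S.evol r.1).symm (ketBra (ket r.2)))

/-- The median-of-means estimate of `tr(ρ O)` from `N` records, with `B` batches. -/
def ShadowProtocol.estimate {ι : Type} [Fintype ι] [DecidableEq ι] (S : ShadowProtocol ι)
    (B : ℕ) {N : ℕ} (r : Fin N → S.Setting × ι) (O : Matrix ι ι ℂ) : ℝ :=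
  medianOfMeans B fun i => (S.snapshot (r i) * O).trace.re

/-! ### Random Clifford measurements -/

/-- Labels of the computational basis of `n` qubits: bit strings of length `n`. -/
abbrev Qubits (n : ℕ) : Type := Fin n → ZMod 2

/-- `(-1)^(b ⬝ y)`. -/
def pauliSign {n : ℕ} (b y : Qubits n) : ℂ := ∏ i, (-1 : ℂ) ^ (b i * y i).val

/-- The Pauli string `X^a Z^b`, i.e. `|y⟩ ↦ (-1)^(b ⬝ y) |y + a⟩`. -/
def pauliString {n : ℕ} (a b : Qubits n) : Matrix (Qubits n) (Qubits n) ℂ :=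
  Matrix.of fun x y => if x = y + a then pauliSign b y else 0

/-- The `n`-qubit Pauli group: Pauli strings with phases `±1`, `±i`. -/
def pauliGroup (n : ℕ) : Set (Matrix (Qubits n) (Qubits n) ℂ) :=
  {P | ∃ (c : ℂ) (a b : Qubits n), c ^ 4 = 1 ∧ P = c • pauliString a b}

/-- The unitaries that normalise the Pauli group. -/
def cliffordUnitaries (n : ℕ) : Subgroup (unitary (Matrix (Qubits n) (Qubits n) ℂ)) where
  carrier := {U | ∀ P, P ∈ pauliGroup n ↔ Unitary.conjStarAlgAut ℂ _ U P ∈ pauliGroup n}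
  one_mem' := fun P => by simp
  mul_mem' := fun {U V} hU hV P => by
    rw [hV P, hU _, ← Unitary.conjStarAlgAut_mul_apply]
  inv_mem' := fun {U} hU P => by
    rw [hU (Unitary.conjStarAlgAut ℂ _ U⁻¹ P), ← Unitary.conjStarAlgAut_mul_apply]
    simp

/-- The `n`-qubit Clifford group modulo global phases: each class of unitaries is represented by the
conjugation `X ↦ U X U†`. -/
def cliffordGroup (n : ℕ) :
    Subgroup (Matrix (Qubits n) (Qubits n) ℂ ≃⋆ₐ[ℂ] Matrix (Qubits n) (Qubits n) ℂ) :=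
  (cliffordUnitaries n).map (Unitary.conjStarAlgAut ℂ (Matrix (Qubits n) (Qubits n) ℂ))

theorem pauliGroup_finite (n : ℕ) : (pauliGroup n).Finite := by
  have h4 : {c : ℂ | c ^ 4 = 1}.Finite := by
    have := (Polynomial.nthRoots 4 (1 : ℂ)).toFinset.finite_toSet
    refine this.subset fun c hc => ?_
    simpa [Polynomial.mem_nthRoots] using hc
  have h := (h4.prod (Set.finite_univ (α := Qubits n × Qubits n))).image
    (fun t => t.1 • pauliString t.2.1 t.2.2)
  refine h.subset ?_
  rintro P ⟨c, a, b, hc, rfl⟩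
  exact ⟨(c, a, b), ⟨hc, trivial⟩, rfl⟩

theorem sum_pauliSign {n : ℕ} (y z : Qubits n) :
    ∑ b : Qubits n, pauliSign b y * pauliSign b z = if z = y then (2 : ℂ) ^ n else 0 := by
  have key : ∀ u v : ZMod 2, ∑ c : ZMod 2, (-1 : ℂ) ^ (c * u).val * (-1 : ℂ) ^ (c * v).val
      = if v = u then 2 else 0 := by
    intro u v
    rw [show (Finset.univ : Finset (ZMod 2)) = {0, 1} from rfl]
    rw [Finset.sum_pair (by decide)]
    fin_cases u <;> fin_cases v
    · change (-1 : ℂ) ^ 0 * (-1) ^ 0 + (-1) ^ 0 * (-1) ^ 0 = 2; norm_num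
    · change (-1 : ℂ) ^ 0 * (-1) ^ 0 + (-1) ^ 0 * (-1) ^ 1 = 0; norm_num
    · change (-1 : ℂ) ^ 0 * (-1) ^ 0 + (-1) ^ 1 * (-1) ^ 0 = 0; norm_num
    · change (-1 : ℂ) ^ 0 * (-1) ^ 0 + (-1) ^ 1 * (-1) ^ 1 = 2; norm_num
  have h := Finset.prod_univ_sum (fun _ : Fin n => (Finset.univ : Finset (ZMod 2)))
    (fun i c => (-1 : ℂ) ^ (c * y i).val * (-1 : ℂ) ^ (c * z i).val)
  rw [Fintype.piFinset_univ] at h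
  simp only [pauliSign, ← Finset.prod_mul_distrib]
  rw [← h]
  simp only [key]
  split_ifs with hz
  · subst hz; simp
  · obtain ⟨i, hi⟩ := Function.ne_iff.1 hz
    exact Finset.prod_eq_zero (Finset.mem_univ i) (by simp [hi])

theorem single_eq_sum_pauliString {n : ℕ} (x y : Qubits n) :
    Matrix.single x y (1 : ℂ)
      = ((2 : ℂ) ^ n)⁻¹ • ∑ b : Qubits n, pauliSign b y • pauliString (x - y) b := by
  ext u v
  simp only [Matrix.smul_apply, Matrix.sum_apply, pauliString, Matrix.of_apply, smul_eq_mul,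
    mul_ite, mul_zero, Matrix.single_apply]
  by_cases huv : u = v + (x - y)
  · simp only [if_pos huv, sum_pauliSign]
    by_cases hv : v = y
    · subst hv; simp [huv]
    · rw [if_neg (fun h => hv h.2.symm), if_neg hv, mul_zero]
  · simp only [if_neg huv, Finset.sum_const_zero, mul_zero]
    rw [if_neg]
    rintro ⟨rfl, rfl⟩
    exact huv (by abel)

instance cliffordGroup_finite (n : ℕ) : Finite (cliffordGroup n) := by
  have : Finite (pauliGroup n) := pauliGroup_finite n
  have hmem : ∀ (g : cliffordGroup n) (a b : Qubits n), g.1 (pauliString a b) ∈ pauliGroup n := by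
    rintro ⟨g, U, hU, rfl⟩ a b
    exact (hU _).1 ⟨1, a, b, by simp, by simp⟩
  refine Finite.of_injective
    (fun (g : cliffordGroup n) (t : Qubits n × Qubits n) =>
      (⟨g.1 (pauliString t.1 t.2), hmem g t.1 t.2⟩ : pauliGroup n)) ?_
  intro g h hgh
  have hP : ∀ a b, g.1 (pauliString a b) = h.1 (pauliString a b) := fun a b =>
    congrArg Subtype.val (congrFun hgh (a, b))
  apply Subtype.ext
  apply StarAlgEquiv.ext
  intro A
  rw [Matrix.matrix_eq_sum_single A]
  simp only [map_sum]
  refine Finset.sum_congr rfl fun x _ => Finset.sum_congr rfl fun y _ => ?_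
  have hs : Matrix.single x y (A x y) = A x y • Matrix.single x y (1 : ℂ) := by
    rw [Matrix.smul_single, smul_eq_mul, mul_one]
  rw [hs, single_eq_sum_pauliString]
  simp only [map_smul, map_sum, hP]

instance cliffordGroup_fintype (n : ℕ) : Fintype (cliffordGroup n) := Fintype.ofFinite _

/-- Random Clifford measurements: uniform over the Clifford group, with
`M⁻¹(X) = (2^n + 1) X - tr(X) 1`. -/
def cliffordProtocol (n : ℕ) : ShadowProtocol (Qubits n) where
  Setting := cliffordGroup n
  law := PMF.uniformOfFintype (cliffordGroup n)
  evol := fun g => g.1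
  invChannel := fun X => ((2 : ℂ) ^ n + 1) • X - X.trace • 1

/-! ### Biased measurements in mutually unbiased bases -/

/-- The `2^n + 1` orthonormal bases `{U_j† |k⟩}_k` form a complete set of mutually unbiased bases of
`(ℂ²)^⊗n`, the basis with index `0` being the computational one. -/
def IsCompleteMUB (n : ℕ) (U : Fin (2 ^ n + 1) → unitary (Matrix (Qubits n) (Qubits n) ℂ)) :
    Prop :=
  U 0 = 1 ∧ ∀ i j, i ≠ j → ∀ k l : Qubits n,
    ‖star ((star (U i : Matrix (Qubits n) (Qubits n) ℂ)).mulVec (ket k)) ⬝ᵥ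
      (star (U j : Matrix (Qubits n) (Qubits n) ℂ)).mulVec (ket l)‖ ^ 2 = 1 / 2 ^ n

/-- The biased law on the bases: `1/2` for the computational one, `1/2^(n+1)` for each other one. -/
def biasedLaw (n : ℕ) : PMF (Fin (2 ^ n + 1)) :=
  PMF.ofFintype (fun j => if j = 0 then 2⁻¹ else (2 ^ (n + 1))⁻¹) (by
    rw [Fin.sum_univ_succ]
    simp only [if_true, Fin.succ_ne_zero, if_false, Finset.sum_const, Finset.card_univ,
      Fintype.card_fin, nsmul_eq_mul, Nat.cast_pow, Nat.cast_ofNat]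
    rw [pow_succ, ENNReal.mul_inv (by simp) (by simp), ← mul_assoc,
      ENNReal.mul_inv_cancel (by simp) (by simp), one_mul, ENNReal.inv_two_add_inv_two])

/-- Biased MUB measurements, with
`M⁻¹(X) = 2^(n+1) [X - (2^n - 1)/2^n ∑_k tr(X |k⟩⟨k|) |k⟩⟨k|] - tr(X)/2^n 1`. -/
def mubProtocol (n : ℕ) (U : Fin (2 ^ n + 1) → unitary (Matrix (Qubits n) (Qubits n) ℂ)) :
    ShadowProtocol (Qubits n) where
  Setting := Fin (2 ^ n + 1)
  law := biasedLaw n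
  evol := fun j => Unitary.conjStarAlgAut ℂ _ (U j)
  invChannel := fun X =>
    (2 : ℂ) ^ (n + 1) • (X - (((2 : ℂ) ^ n - 1) / 2 ^ n) •
        ∑ k : Qubits n, (X * ketBra (ket k)).trace • ketBra (ket k))
      - (X.trace / 2 ^ n) • 1

/-- The two kinds of classical shadow protocols: random Clifford, or biased MUB with some complete
set of mutually unbiased bases that contains the computational one. -/
def IsCliffordOrBiasedMUB (n : ℕ) (S : ShadowProtocol (Qubits n)) : Prop :=
  S = cliffordProtocol n ∨ ∃ U, IsCompleteMUB n U ∧ S = mubProtocol n U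

end

/-!
Every probability below is a sum over a finite set, so the argument is a Chernoff-type count on top
of two moment computations.

*Concentration.* Relative frequencies obey Hoeffding's inequality (`measure_relFreq_tail`). For
medians of means, Chebyshev makes each batch mean inaccurate with probability at most `1 / 32` as
soon as the variables have a second moment bounded by a constant; batches use disjoint groups of
samples, hence are independent, and half of `B` independent batches fail with probability at most
`exp (-B)` (`measure_medianOfMeans_tail`). With `B = ⌈2 L⌉` this leaves room for a union bound over
`2 K` observables and the two kinds of measurements. It remains to see that a snapshot estimates
`tr(ρ O)` without bias and with second moment at most `16`, whatever the dimension `d = 2 ^ n`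
(`IsCliffordOrBiasedMUB.moments`).

*Random Clifford measurements.* Both moments follow from the Clifford group being a unitary
3-design (`cliffordMoment_eq_symTrace`). The third moment is trilinear, so it may be evaluated on
Pauli strings. Conjugation by Pauli strings kills it unless the three strings multiply to a scalar.
The Clifford operations `(1 + J) / √2`, with `J` an anti-Hermitian multiple of a Pauli string, act
as symplectic transvections; by Witt's theorem the moment then takes one value on `(P, P†, 1)` and
one on `(P, Q, (PQ)†)` for independent commuting `P`, `Q`, and vanishes for anticommuting ones. The
two values are forced by the purity of the measured basis state, through the completeness relation
`∑_P tr(P A) P† = d A`.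

*Biased mutually unbiased bases.* A complete set of such bases meets the Welch bound, so it is a
2-design (`IsCompleteMUB.sum_trace_mul_trace`); this gives the mean. The single-shot estimates are
themselves bounded: a vector `w` of a basis other than the computational one has all entries of
modulus `1 / √d`, so its squared overlap with a superposition of two basis vectors is at most `2 / d`,
which cancels the factor `2 d` of the inverse channel.
-/

section Concentration

open MeasureTheory ProbabilityTheory

/-! ### Independent samples -/

theorem iidPMF_toMeasure {α : Type} [Fintype α] [MeasurableSpace α] [MeasurableSingletonClass α]
    (p : PMF α) (N : ℕ) :
    (iidPMF p N).toMeasure = Measure.pi fun _ : Fin N => p.toMeasure := by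
  refine Measure.ext_of_singleton fun ω => ?_
  rw [PMF.toMeasure_apply_singleton _ _ (measurableSet_singleton ω), Measure.pi_singleton]
  simp only [PMF.toMeasure_apply_singleton _ _ (measurableSet_singleton _)]
  rfl

theorem iidPMF_toOuterMeasure {α : Type} [Fintype α] [MeasurableSpace α]
    [MeasurableSingletonClass α] (p : PMF α) (N : ℕ) (s : Set (Fin N → α)) :
    (iidPMF p N).toOuterMeasure s = Measure.pi (fun _ : Fin N => p.toMeasure) s := by
  rw [← iidPMF_toMeasure,
    PMF.toMeasure_apply_eq_toOuterMeasure_apply _ (Set.toFinite s).measurableSet]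

theorem integral_pi_eval {α : Type} [Fintype α] [MeasurableSpace α]
    [MeasurableSingletonClass α] (p : PMF α) {N : ℕ} (f : α → ℝ) (i : Fin N) :
    ∫ x, f (x i) ∂(Measure.pi fun _ : Fin N => p.toMeasure) = ∫ a, f a ∂p.toMeasure := by
  have h := (measurePreserving_eval (fun _ : Fin N => p.toMeasure) i).map_eq
  have h2 := integral_map (μ := Measure.pi fun _ : Fin N => p.toMeasure) (f := f)
    (measurable_pi_apply i).aemeasurable (measurable_of_finite f).aestronglyMeasurable
  rw [← h2]
  exact congrArg (fun ν => ∫ a, f a ∂ν) h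

/-- Functions of disjoint groups of coordinates are independent under a product measure. -/
theorem integral_mul_of_dependsOn {α : Type} [Fintype α] [MeasurableSpace α]
    [MeasurableSingletonClass α] (p : PMF α) {N : ℕ} {S T : Finset (Fin N)} (hST : Disjoint S T)
    {f g : (Fin N → α) → ℝ} (hf : DependsOn f (S : Set (Fin N)))
    (hg : DependsOn g (T : Set (Fin N))) :
    ∫ x, f x * g x ∂(Measure.pi fun _ => p.toMeasure)
      = (∫ x, f x ∂(Measure.pi fun _ => p.toMeasure))
        * ∫ x, g x ∂(Measure.pi fun _ => p.toMeasure) := by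
  have hne : Nonempty α := p.support_nonempty.to_type
  obtain ⟨f', rfl⟩ := dependsOn_iff_exists_comp.1 hf
  obtain ⟨g', rfl⟩ := dependsOn_iff_exists_comp.1 hg
  have hind : iIndepFun (fun (i : Fin N) (ω : Fin N → α) => ω i)
      (Measure.pi fun _ => p.toMeasure) :=
    iIndepFun_pi (X := fun _ => id) fun _ => aemeasurable_id
  have h2 := (hind.indepFun_finset S T hST fun i => measurable_pi_apply i).comp
    (φ := f') (ψ := g') (measurable_of_finite f') (measurable_of_finite g')
  exact h2.integral_fun_mul_eq_mul_integral (measurable_of_finite _).aestronglyMeasurable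
    (measurable_of_finite _).aestronglyMeasurable

/-- The expectation of a product of nonnegative functions of disjoint groups of samples. -/
theorem integral_prod_le_pow_of_dependsOn {α : Type} [Fintype α] [MeasurableSpace α]
    [MeasurableSingletonClass α] (p : PMF α) {N B : ℕ} {T : Fin B → Finset (Fin N)}
    (hT : Pairwise fun k l => Disjoint (T k) (T l)) {f : Fin B → (Fin N → α) → ℝ}
    (hf : ∀ k, DependsOn (f k) (T k : Set (Fin N))) (h0 : ∀ k x, 0 ≤ f k x) {c : ℝ}
    (hc : ∀ k, ∫ x, f k x ∂(Measure.pi fun _ => p.toMeasure) ≤ c) :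
    ∫ x, ∏ k, f k x ∂(Measure.pi fun _ => p.toMeasure) ≤ c ^ B := by
  have key : ∀ s : Finset (Fin B),
      ∫ x, ∏ k ∈ s, f k x ∂(Measure.pi fun _ => p.toMeasure) ≤ c ^ s.card := by
    intro s
    induction s using Finset.induction_on with
    | empty => simp
    | insert k s hk ih =>
      simp only [Finset.prod_insert hk, Finset.card_insert_of_notMem hk, pow_succ']
      rw [integral_mul_of_dependsOn p (S := T k) (T := s.biUnion T) ?_ (hf k) ?_]
      · exact mul_le_mul (hc k) ih (integral_nonneg fun x => Finset.prod_nonneg fun l _ => h0 l x)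
          ((integral_nonneg (h0 k)).trans (hc k))
      · rw [Finset.disjoint_biUnion_right]
        intro l hl
        exact hT fun h => hk (h ▸ hl)
      · intro x y hxy
        refine Finset.prod_congr rfl fun l hl => hf l fun i hi => hxy i ?_
        exact Finset.mem_coe.2 (Finset.mem_biUnion.2 ⟨l, hl, hi⟩)
  simpa using key Finset.univ

/-! ### Relative frequencies -/

/-- Hoeffding's inequality (one-sided) for independent samples of a function valued in `[0, 1]`. -/
theorem measure_sum_sub_mean_tail {α : Type} [Fintype α] [MeasurableSpace α]
    [MeasurableSingletonClass α] (p : PMF α) (N : ℕ) {X : α → ℝ} (hX : ∀ a, X a ∈ Set.Icc (0 : ℝ) 1)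
    {m : ℝ} (hm : ∫ a, X a ∂p.toMeasure = m) {ε : ℝ} (hε : 0 ≤ ε) :
    (Measure.pi fun _ : Fin N => p.toMeasure).real {x | N * ε ≤ ∑ i, (X (x i) - m)}
      ≤ Real.exp (-(2 * N * ε ^ 2)) := by
  rcases Nat.eq_zero_or_pos N with rfl | hN
  · exact measureReal_le_one.trans (by simp)
  have hind : iIndepFun (fun (i : Fin N) (ω : Fin N → α) => X (ω i) - m)
      (Measure.pi fun _ : Fin N => p.toMeasure) :=
    iIndepFun_pi (X := fun _ b => X b - m) fun _ => (measurable_of_finite _).aemeasurable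
  have hint : ∀ i : Fin N, ∫ ω, X (ω i) ∂(Measure.pi fun _ : Fin N => p.toMeasure) = m :=
    fun i => (integral_pi_eval p X i).trans hm
  have hsub : ∀ i : Fin N, HasSubgaussianMGF (fun ω : Fin N → α => X (ω i) - m)
      ((‖(1 : ℝ) - 0‖₊ / 2) ^ 2) (Measure.pi fun _ : Fin N => p.toMeasure) := by
    intro i
    have := hasSubgaussianMGF_of_mem_Icc (μ := Measure.pi fun _ : Fin N => p.toMeasure)
      (X := fun ω => X (ω i)) (measurable_of_finite _).aemeasurable
      (Filter.Eventually.of_forall fun ω => hX (ω i))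
    rwa [hint i] at this
  have hNε : (0 : ℝ) ≤ N * ε := by positivity
  have h := HasSubgaussianMGF.measure_sum_ge_le_of_iIndepFun hind (s := Finset.univ)
    (fun i _ => hsub i) hNε
  refine h.trans_eq (congrArg Real.exp ?_)
  have hN' : (N : ℝ) ≠ 0 := by positivity
  simp
  field_simp

/-- Hoeffding's inequality for the relative frequency of an outcome. -/
theorem measure_relFreq_tail {α : Type} [Fintype α] [DecidableEq α] [MeasurableSpace α]
    [MeasurableSingletonClass α] (p : PMF α) (N : ℕ) (a : α) {ε : ℝ} (hε : 0 < ε) :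
    (Measure.pi fun _ : Fin N => p.toMeasure).real {x | ε < |relFreq x a - (p a).toReal|}
      ≤ 2 * Real.exp (-(2 * N * ε ^ 2)) := by
  rcases Nat.eq_zero_or_pos N with rfl | hN
  · exact measureReal_le_one.trans (by norm_num)
  let X : α → ℝ := fun b => if b = a then 1 else 0
  have hX : ∫ b, X b ∂p.toMeasure = (p a).toReal := by
    rw [PMF.integral_eq_sum]
    simp [X]
  have hX' : ∫ b, (1 - X b) ∂p.toMeasure = 1 - (p a).toReal := by
    rw [integral_sub .of_finite .of_finite, hX]
    simp
  have hmem : ∀ b, X b ∈ Set.Icc (0 : ℝ) 1 := fun b => by by_cases h : b = a <;> simp [X, h]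
  have hmem' : ∀ b, 1 - X b ∈ Set.Icc (0 : ℝ) 1 := fun b => by by_cases h : b = a <;> simp [X, h]
  have h1 := measure_sum_sub_mean_tail p N hmem hX hε.le
  have h2 := measure_sum_sub_mean_tail p N hmem' hX' hε.le
  have hfreq : ∀ x : Fin N → α, ∑ i, (X (x i) - (p a).toReal)
      = N * (relFreq x a - (p a).toReal) := by
    intro x
    have hN' : (N : ℝ) ≠ 0 := by positivity
    simp only [Finset.sum_sub_distrib, Finset.sum_const, Finset.card_univ, Fintype.card_fin,
      nsmul_eq_mul, X, Finset.sum_boole, relFreq]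
    field_simp
  have hneg : ∀ x : Fin N → α, ∑ i, (1 - X (x i) - (1 - (p a).toReal))
      = N * -(relFreq x a - (p a).toReal) := by
    intro x
    rw [mul_neg, ← hfreq, ← Finset.sum_neg_distrib]
    exact Finset.sum_congr rfl fun i _ => by ring
  have hsub : {x : Fin N → α | ε < |relFreq x a - (p a).toReal|} ⊆
      {x | N * ε ≤ ∑ i, (X (x i) - (p a).toReal)} ∪
        {x | N * ε ≤ ∑ i, (1 - X (x i) - (1 - (p a).toReal))} := by
    intro x hx
    simp only [Set.mem_union, Set.mem_ofPred_eq, hneg, hfreq] at hx ⊢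
    rcases lt_abs.1 hx with h | h
    · left; gcongr
    · right; gcongr
  calc _ ≤ _ := measureReal_mono hsub
    _ ≤ _ := measureReal_union_le _ _
    _ ≤ _ := add_le_add h1 h2
    _ = _ := by ring

/-! ### Medians of means -/

/-- If the median of `y` is farther than `ε` from `m`, then so are at least half of the values. -/
theorem le_two_mul_card_of_lt_abs_median {B : ℕ} (hB : 0 < B) (y : Fin B → ℝ) {m ε : ℝ}
    (h : ε < |median y - m|) : B ≤ 2 * (Finset.univ.filter fun k => ε < |y k - m|).card := by
  set σ := Tuple.sort y with hσ
  have hmono : Monotone (y ∘ σ) := Tuple.monotone_sort y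
  have hcard : ∀ s : Finset (Fin B), (∀ i ∈ s, ε < |y (σ i) - m|) →
      s.card ≤ (Finset.univ.filter fun k => ε < |y k - m|).card := by
    intro s hs
    rw [← Finset.card_map σ.toEmbedding]
    refine Finset.card_le_card fun k hk => ?_
    obtain ⟨i, hi, rfl⟩ := Finset.mem_map.1 hk
    simpa using hs i hi
  have hlow : (B - 1) / 2 < B := by omega
  have hhigh : B / 2 < B := by omega
  have hle : y (σ ⟨(B - 1) / 2, hlow⟩) ≤ y (σ ⟨B / 2, hhigh⟩) :=
    hmono (by simp only [Fin.mk_le_mk]; omega)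
  have hmed : median y = (y (σ ⟨(B - 1) / 2, hlow⟩) + y (σ ⟨B / 2, hhigh⟩)) / 2 := by
    simp [median, hB, hσ]
  rcases lt_abs.1 h with h | h
  · have := hcard (Finset.Ici ⟨B / 2, hhigh⟩) fun i hi => by
      have hi' : y (σ ⟨B / 2, hhigh⟩) ≤ y (σ i) := hmono (Finset.mem_Ici.1 hi)
      exact lt_abs.2 (Or.inl (by linarith))
    rw [Fin.card_Ici] at this
    simp only at this
    omega
  · have := hcard (Finset.Iic ⟨(B - 1) / 2, hlow⟩) fun i hi => by
      have hi' : y (σ i) ≤ y (σ ⟨(B - 1) / 2, hlow⟩) := hmono (Finset.mem_Iic.1 hi)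
      exact lt_abs.2 (Or.inr (by linarith))
    rw [Fin.card_Iic] at this
    simp only at this
    omega

/-- Each of the first `B` batches of `m` consecutive samples is complete. -/
theorem card_filter_div_eq {N m B : ℕ} (hm : 0 < m) (hN : B * m ≤ N) (k : Fin B) :
    (Finset.univ.filter fun i : Fin N => (i : ℕ) / m = (k : ℕ)).card = m := by
  have h : (Finset.univ.filter fun i : Fin N => (i : ℕ) / m = (k : ℕ)).map Fin.valEmbedding
      = Finset.Ico (k * m) ((k + 1) * m) := by
    ext i
    have hk : ((k : ℕ) + 1) * m ≤ N := le_trans (Nat.mul_le_mul_right m k.2) hN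
    simp only [Finset.mem_map, Finset.mem_filter, Finset.mem_univ, true_and,
      Fin.valEmbedding_apply, Finset.mem_Ico]
    constructor
    · rintro ⟨i, hi, rfl⟩
      exact ⟨by rw [← Nat.le_div_iff_mul_le hm, hi], by rw [← Nat.div_lt_iff_lt_mul hm, hi]; omega⟩
    · rintro ⟨h1, h2⟩
      refine ⟨⟨i, by omega⟩, ?_, rfl⟩
      exact Nat.div_eq_of_lt_le h1 h2
  rw [← Finset.card_map Fin.valEmbedding, h, Nat.card_Ico, add_mul, one_mul]
  omega

/-- Chebyshev's inequality for the mean of a batch of independent samples. -/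
theorem measure_batchMean_tail {α : Type} [Fintype α] [MeasurableSpace α]
    [MeasurableSingletonClass α] (p : PMF α) {N : ℕ} (T : Finset (Fin N)) (hT : 0 < T.card)
    (X : α → ℝ) {m V : ℝ} (hm : ∫ a, X a ∂p.toMeasure = m) (hV : ∫ a, X a ^ 2 ∂p.toMeasure ≤ V)
    {ε : ℝ} (hε : 0 < ε) :
    (Measure.pi fun _ : Fin N => p.toMeasure).real {x | ε < |(∑ i ∈ T, X (x i)) / T.card - m|}
      ≤ V / (T.card * ε ^ 2) := by
  set μ := Measure.pi fun _ : Fin N => p.toMeasure with hμ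
  have hmp := fun i : Fin N => measurePreserving_eval (fun _ : Fin N => p.toMeasure) i
  have hL : ∀ f : (Fin N → α) → ℝ, MemLp f 2 μ := fun f => MemLp.of_discrete
  have hint : ∀ i : Fin N, ∫ ω, X (ω i) ∂μ = m := fun i => (integral_pi_eval p X i).trans hm
  have hvar1 : Var[X; p.toMeasure] ≤ V :=
    (variance_le_expectation_sq (measurable_of_finite _).aestronglyMeasurable).trans hV
  have hvar : ∀ i : Fin N, Var[fun ω => X (ω i); μ] ≤ V := by
    intro i
    refine le_trans (le_of_eq ?_) hvar1
    change Var[X ∘ (fun ω => ω i); μ] = _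
    rw [← variance_map, (hmp i).map_eq]
    · exact (measurable_of_finite _).aemeasurable
    · exact (measurable_pi_apply i).aemeasurable
  have hind : iIndepFun (fun (i : Fin N) (ω : Fin N → α) => X (ω i)) μ :=
    iIndepFun_pi (X := fun _ => X) fun _ => (measurable_of_finite _).aemeasurable
  have hsumvar : Var[∑ i ∈ T, fun ω : Fin N → α => X (ω i); μ] ≤ T.card * V := by
    rw [IndepFun.variance_sum (fun i _ => hL _) fun i _ j _ hij => hind.indepFun hij]
    exact (Finset.sum_le_sum fun i _ => hvar i).trans_eq (by simp)
  have hc : (0 : ℝ) < T.card * ε := by positivity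
  have hch := meas_ge_le_variance_div_sq (hL (∑ i ∈ T, fun ω : Fin N → α => X (ω i))) hc
  have hmean : ∫ ω, (∑ i ∈ T, fun ω : Fin N → α => X (ω i)) ω ∂μ = T.card * m := by
    simp only [Finset.sum_apply]
    rw [integral_finsetSum _ fun i _ => .of_finite]
    simp [hint]
  rw [hmean] at hch
  have hT' : (0 : ℝ) < T.card := by exact_mod_cast hT
  have h1 : μ.real {x | ε < |(∑ i ∈ T, X (x i)) / T.card - m|} ≤
      μ.real {ω | T.card * ε ≤ |(∑ i ∈ T, fun ω : Fin N → α => X (ω i)) ω - T.card * m|} := by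
    refine measureReal_mono fun x hx => ?_
    simp only [Set.mem_ofPred_eq, Finset.sum_apply] at hx ⊢
    have : (∑ i ∈ T, X (x i)) - T.card * m
        = T.card * ((∑ i ∈ T, X (x i)) / T.card - m) := by field_simp
    rw [this, abs_mul, abs_of_pos hT']
    exact mul_le_mul_of_nonneg_left hx.le hT'.le
  have h2 := ENNReal.toReal_le_of_le_ofReal
    (div_nonneg (variance_nonneg _ _) (by positivity)) hch
  refine h1.trans (h2.trans ?_)
  rw [div_le_div_iff₀ (by positivity) (by positivity)]
  calc Var[∑ i ∈ T, fun ω : Fin N → α => X (ω i); μ] * (T.card * ε ^ 2)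
      ≤ (T.card * V) * (T.card * ε ^ 2) := by gcongr
    _ = V * (T.card * ε) ^ 2 := by ring

/-- Median of means: when every batch mean is accurate with probability at least `31/32`, the median
is accurate except with probability exponentially small in the number of batches. -/
theorem measure_medianOfMeans_tail {α : Type} [Fintype α] [MeasurableSpace α]
    [MeasurableSingletonClass α] (p : PMF α) {N B : ℕ} (hB : 0 < B) (hNB : 0 < N / B)
    (X : α → ℝ) {m V : ℝ} (hm : ∫ a, X a ∂p.toMeasure = m) (hV : ∫ a, X a ^ 2 ∂p.toMeasure ≤ V)
    {ε : ℝ} (hε : 0 < ε) (hVε : V / ((N / B : ℕ) * ε ^ 2) ≤ 1 / 32) :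
    (Measure.pi fun _ : Fin N => p.toMeasure).real
      {x | ε < |medianOfMeans B (fun i => X (x i)) - m|} ≤ Real.exp (-B) := by
  set μ := Measure.pi fun _ : Fin N => p.toMeasure with hμ
  let T : Fin B → Finset (Fin N) := fun k =>
    Finset.univ.filter fun i : Fin N => (i : ℕ) / (N / B) = (k : ℕ)
  have hTcard : ∀ k, (T k).card = N / B := card_filter_div_eq hNB (Nat.mul_div_le N B)
  let Y : (Fin N → α) → Fin B → ℝ := fun x k => (∑ i ∈ T k, X (x i)) / (N / B : ℕ)
  have hbad : ∀ k, μ.real {x | ε < |Y x k - m|} ≤ 1 / 32 := by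
    intro k
    have h := measure_batchMean_tail p (T k) (by rw [hTcard]; exact hNB) X hm hV hε
    rw [hTcard] at h
    exact h.trans hVε
  -- A bad batch is given the weight `w ^ 2`; then a bad median forces the product of the weights
  -- above `w ^ B`.
  set w : ℝ := 2 * Real.exp 1 with hw
  have hw1 : 1 ≤ w := by linarith [Real.add_one_le_exp (1 : ℝ)]
  -- This is where the bound `1 / 32` for bad batches is used up: `1 + w ^ 2 / 32 ≤ 2`.
  have hw2 : w ^ 2 ≤ 32 := by
    have := Real.exp_one_lt_d9
    have h0 := Real.exp_pos 1
    rw [hw]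
    nlinarith
  let f : Fin B → (Fin N → α) → ℝ := fun k x => if ε < |Y x k - m| then w ^ 2 else 1
  have hf1 : ∀ k x, 1 ≤ f k x := fun k x => by
    by_cases h : ε < |Y x k - m|
    · simp only [f, if_pos h]; exact one_le_pow₀ hw1
    · simp only [f, if_neg h]; exact le_rfl
  have hfint : ∀ k, ∫ x, f k x ∂μ ≤ 2 := by
    intro k
    have h1 : ∀ x, f k x ≤ 1 + ({x | ε < |Y x k - m|} : Set (Fin N → α)).indicator
        (fun _ => (32 : ℝ)) x := by
      intro x
      by_cases h : ε < |Y x k - m|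
      · rw [Set.indicator_of_mem (show x ∈ {x | ε < |Y x k - m|} from h)]
        simp only [f, if_pos h]
        linarith
      · rw [Set.indicator_of_notMem (show x ∉ {x | ε < |Y x k - m|} from h)]
        simp only [f, if_neg h]
        linarith
    calc ∫ x, f k x ∂μ ≤ ∫ x, (1 + ({x | ε < |Y x k - m|} : Set (Fin N → α)).indicator
            (fun _ => (32 : ℝ)) x) ∂μ := integral_mono .of_finite .of_finite h1
      _ = 1 + μ.real {x | ε < |Y x k - m|} * 32 := by
          rw [integral_add .of_finite .of_finite,
            integral_indicator_const _ (Set.toFinite _).measurableSet]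
          simp
      _ ≤ 2 := by linarith [hbad k]
  have hdep : ∀ k, DependsOn (f k) (T k : Set (Fin N)) := by
    intro k x y hxy
    have : Y x k = Y y k := by
      simp only [Y]
      rw [Finset.sum_congr rfl fun i hi => by rw [hxy i hi]]
    simp only [f, this]
  have hdisj : Pairwise fun k l => Disjoint (T k) (T l) := by
    intro k l hkl
    refine Finset.disjoint_filter.2 fun i _ h1 h2 => hkl (Fin.ext (h1.symm.trans h2))
  have hprod := integral_prod_le_pow_of_dependsOn p hdisj hdep
    (fun k x => zero_le_one.trans (hf1 k x)) hfint
  have hmarkov := mul_meas_ge_le_integral_of_nonneg (μ := μ) (f := fun x => ∏ k, f k x)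
    (Filter.Eventually.of_forall fun x => Finset.prod_nonneg fun k _ => zero_le_one.trans (hf1 k x))
    .of_finite (w ^ B)
  have hsub : μ.real {x | ε < |medianOfMeans B (fun i => X (x i)) - m|}
      ≤ μ.real {x | w ^ B ≤ ∏ k, f k x} := by
    refine measureReal_mono fun x hx => ?_
    have h := le_two_mul_card_of_lt_abs_median hB (Y x) hx
    change w ^ B ≤ ∏ k, f k x
    simp only [f]
    rw [Finset.prod_ite, Finset.prod_const, Finset.prod_const_one, mul_one, ← pow_mul]
    exact pow_le_pow_right₀ hw1 h
  have hwB : (0 : ℝ) < w ^ B := by positivity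
  have h3 : μ.real {x | ε < |medianOfMeans B (fun i => X (x i)) - m|} ≤ 2 ^ B / w ^ B := by
    rw [le_div_iff₀ hwB, mul_comm]
    exact (mul_le_mul_of_nonneg_left hsub hwB.le).trans (hmarkov.trans hprod)
  refine h3.trans_eq ?_
  rw [← div_pow, hw, div_mul_cancel_left₀ two_ne_zero, ← Real.exp_neg, ← Real.exp_nat_mul, mul_neg,
    mul_one]

/-! ### Union bounds -/

theorem ofReal_one_sub_le_toOuterMeasure {Ω : Type} (q : PMF Ω) {s : Set Ω} {δ : ℝ} (hδ : 0 ≤ δ)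
    (h : q.toOuterMeasure sᶜ ≤ ENNReal.ofReal δ) :
    ENNReal.ofReal (1 - δ) ≤ q.toOuterMeasure s := by
  rw [ENNReal.ofReal_sub _ hδ, ENNReal.ofReal_one, tsub_le_iff_right]
  calc 1 = q.toOuterMeasure (s ∪ sᶜ) := by
        rw [Set.union_compl_self]
        exact ((q.toOuterMeasure_apply_eq_one_iff _).2 (Set.subset_univ _)).symm
    _ ≤ q.toOuterMeasure s + q.toOuterMeasure sᶜ := measure_union_le _ _
    _ ≤ _ := by gcongr

theorem toOuterMeasure_exists_le {Ω T : Type} [Fintype T] (q : PMF Ω) {s : T → Set Ω} {η δ : ℝ}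
    (h : ∀ t, q.toOuterMeasure (s t) ≤ ENNReal.ofReal η) (hδ : Fintype.card T * η ≤ δ) :
    q.toOuterMeasure {x | ∃ t, x ∈ s t} ≤ ENNReal.ofReal δ := by
  have : {x | ∃ t, x ∈ s t} = ⋃ t, s t := by ext; simp
  rw [this]
  calc q.toOuterMeasure (⋃ t, s t) ≤ ∑ t, q.toOuterMeasure (s t) := measure_iUnion_fintype_le _ _
    _ ≤ ∑ _t : T, ENNReal.ofReal η := Finset.sum_le_sum fun t _ => h t
    _ = ENNReal.ofReal (Fintype.card T * η) := by
        rw [Finset.sum_const, Finset.card_univ, nsmul_eq_mul,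
          ENNReal.ofReal_mul (Nat.cast_nonneg _), ENNReal.ofReal_natCast]
    _ ≤ _ := ENNReal.ofReal_le_ofReal hδ

theorem prodPMF_map_fst {α β : Type} (p : PMF α) (q : PMF β) :
    (prodPMF p q).map Prod.fst = p := by
  rw [prodPMF, PMF.map_bind]
  simp only [PMF.map_comp]
  have : ∀ x : α, (Prod.fst ∘ Prod.mk x : β → α) = Function.const β x := fun x => rfl
  simp only [this, PMF.map_const, PMF.bind_pure]

theorem prodPMF_map_snd {α β : Type} (p : PMF α) (q : PMF β) :
    (prodPMF p q).map Prod.snd = q := by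
  rw [prodPMF, PMF.map_bind]
  simp only [PMF.map_comp]
  have : ∀ x : α, (Prod.snd ∘ Prod.mk x : β → β) = id := fun x => rfl
  simp only [this, PMF.map_id, PMF.bind_const]

theorem prodPMF_toOuterMeasure_compl_le {α β : Type} (p : PMF α) (q : PMF β) (A : Set α)
    (B : Set β) :
    (prodPMF p q).toOuterMeasure {w | w.1 ∈ A ∧ w.2 ∈ B}ᶜ
      ≤ p.toOuterMeasure Aᶜ + q.toOuterMeasure Bᶜ := by
  have h : {w : α × β | w.1 ∈ A ∧ w.2 ∈ B}ᶜ = (Prod.fst ⁻¹' Aᶜ) ∪ (Prod.snd ⁻¹' Bᶜ) := by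
    ext w
    simp only [Set.mem_compl_iff, Set.mem_ofPred_eq, Set.mem_union, Set.mem_preimage]
    tauto
  rw [h]
  refine (measure_union_le _ _).trans ?_
  rw [← PMF.toOuterMeasure_map_apply, ← PMF.toOuterMeasure_map_apply, prodPMF_map_fst,
    prodPMF_map_snd]

/-! ### Sample complexity -/

theorem log_two_le_log_div {K : ℕ} (hK : 0 < K) {δ : ℝ} (hδ : 0 < δ) (hδ1 : δ < 1) :
    1 / 2 ≤ Real.log (2 * K / δ) := by
  have hK' : (1 : ℝ) ≤ K := by exact_mod_cast hK
  have h2 : (2 : ℝ) ≤ 2 * K / δ := by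
    rw [le_div_iff₀ hδ]
    nlinarith
  have := Real.log_le_log (by norm_num) h2
  linarith [Real.log_two_gt_d9]

theorem exp_neg_log_div {K : ℕ} (hK : 0 < K) {δ : ℝ} (hδ : 0 < δ) :
    Real.exp (-Real.log (2 * K / δ)) = δ / (2 * K) := by
  have hK' : (0 : ℝ) < K := by exact_mod_cast hK
  rw [← Real.log_inv, Real.exp_log (by positivity), inv_div]

/-- Relative frequencies estimate the probabilities of `2 K` outcomes at once from
`O(log (K / δ) / ε ^ 2)` samples. -/
theorem relFreq_sample_complexity {α T : Type} [Fintype α] [DecidableEq α] [Fintype T] (p : PMF α)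
    (a : T → α) {K : ℕ} (hK : 0 < K) (hT : Fintype.card T = 2 * K) {ε δ : ℝ} (hε : 0 < ε)
    (hδ : 0 < δ) (hδ1 : δ < 1) {N : ℕ} (hN : 4096 * Real.log (2 * K / δ) / ε ^ 2 ≤ N) :
    (iidPMF p N).toOuterMeasure {x | ∃ t, ε < |relFreq x (a t) - (p (a t)).toReal|}
      ≤ ENNReal.ofReal (δ / 2) := by
  let _ : MeasurableSpace α := ⊤
  have _ : MeasurableSingletonClass α := ⟨fun _ => trivial⟩
  set L := Real.log (2 * K / δ) with hL
  have hL0 : 1 / 2 ≤ L := log_two_le_log_div hK hδ hδ1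
  have hK' : (1 : ℝ) ≤ K := by exact_mod_cast hK
  refine toOuterMeasure_exists_le (iidPMF p N)
    (s := fun t => {x | ε < |relFreq x (a t) - (p (a t)).toReal|})
    (η := 2 * Real.exp (-L) ^ 4) (fun t => ?_) ?_
  · rw [iidPMF_toOuterMeasure, ← ENNReal.ofReal_toReal (measure_ne_top _ _)]
    refine ENNReal.ofReal_le_ofReal ((measure_relFreq_tail p N (a t) hε).trans ?_)
    rw [← Real.exp_nat_mul]
    rw [div_le_iff₀ (by positivity)] at hN
    gcongr
    push_cast
    linarith
  · rw [hT, hL, exp_neg_log_div hK hδ]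
    have hx : δ / (2 * K) ≤ 1 / 2 := by
      rw [div_le_div_iff₀ (by positivity) (by positivity)]; nlinarith
    have hx0 : 0 < δ / (2 * K) := by positivity
    have hδK : (2 * K : ℝ) * (δ / (2 * K)) = δ := by field_simp
    push_cast
    calc (2 * K : ℝ) * (2 * (δ / (2 * K)) ^ 4)
        = 2 * ((2 * K : ℝ) * (δ / (2 * K))) * (δ / (2 * K)) ^ 3 := by ring
      _ ≤ 2 * δ * (1 / 2) ^ 3 := by rw [hδK]; gcongr
      _ ≤ δ / 2 := by nlinarith

/-- Median of means estimates `2 K` expectations of variables with second moment at most `16` at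
once from `O(log (K / δ) / ε ^ 2)` samples. -/
theorem medianOfMeans_sample_complexity {α T : Type} [Fintype α] [Fintype T] (p : PMF α)
    (X : T → α → ℝ) (m : T → ℝ) (hm : ∀ t, ∑ a, (p a).toReal * X t a = m t)
    (hm1 : ∀ t, |m t| ≤ 1) (hV : ∀ t, ∑ a, (p a).toReal * X t a ^ 2 ≤ 16)
    {K : ℕ} (hK : 0 < K) (hT : Fintype.card T = 2 * K) {ε δ : ℝ} (hε : 0 < ε)
    (hδ : 0 < δ) (hδ1 : δ < 1) {N : ℕ} (hN : 4096 * Real.log (2 * K / δ) / ε ^ 2 ≤ N) :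
    (iidPMF p N).toOuterMeasure {x | ∃ t, ε <
        |medianOfMeans ⌈2 * Real.log (2 * K / δ)⌉₊ (fun i => X t (x i)) - m t|}
      ≤ ENNReal.ofReal (δ / 2) := by
  let _ : MeasurableSpace α := ⊤
  have _ : MeasurableSingletonClass α := ⟨fun _ => trivial⟩
  have hK' : (1 : ℝ) ≤ K := by exact_mod_cast hK
  set L := Real.log (2 * K / δ) with hL
  have hL0 : 1 / 2 ≤ L := log_two_le_log_div hK hδ hδ1
  set B := ⌈2 * L⌉₊ with hBdef
  have hBL : 2 * L ≤ B := Nat.le_ceil _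
  -- `L ≥ 1 / 2` absorbs the rounding of the number of batches.
  have hBL' : (B : ℝ) ≤ 4 * L := by
    have := Nat.ceil_lt_add_one (show 0 ≤ 2 * L by linarith)
    linarith
  have hB : 0 < B := Nat.ceil_pos.2 (by linarith)
  rw [div_le_iff₀ (by positivity)] at hN
  refine toOuterMeasure_exists_le (iidPMF p N)
    (s := fun t => {x | ε < |medianOfMeans B (fun i => X t (x i)) - m t|})
    (η := Real.exp (-L) ^ 2) (fun t => ?_) ?_
  · rcases Nat.eq_zero_or_pos (N / B) with h0 | h0
    · -- Batches of size zero: the estimate is `0`, and there are so few samples that `1 ≤ ε`.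
      have hNB : (N : ℝ) < B := by exact_mod_cast (Nat.div_eq_zero_iff_lt hB).1 h0
      have hε1 : 1 ≤ ε := by
        by_contra hlt
        have : ε ^ 2 ≤ 1 := by nlinarith
        have : (N : ℝ) * ε ^ 2 ≤ N * 1 := by gcongr
        linarith
      have hest : ∀ x : Fin N → α, medianOfMeans B (fun i => X t (x i)) = 0 := fun x => by
        simp [medianOfMeans, median, h0]
      have hempty : {x : Fin N → α | ε < |medianOfMeans B (fun i => X t (x i)) - m t|} = ∅ := by
        ext x
        simp only [hest, zero_sub, abs_neg, Set.mem_ofPred_eq, Set.mem_empty_iff_false, iff_false,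
          not_lt]
        exact (hm1 t).trans hε1
      rw [hempty]
      simp
    · rw [iidPMF_toOuterMeasure, ← ENNReal.ofReal_toReal (measure_ne_top _ _)]
      refine ENNReal.ofReal_le_ofReal ((measure_medianOfMeans_tail p hB h0 (X t) (m := m t)
        (V := 16) ?_ ?_ hε ?_).trans ?_)
      · rw [PMF.integral_eq_sum]; exact hm t
      · rw [PMF.integral_eq_sum]; exact hV t
      · have h1 : (1 : ℝ) ≤ (N / B : ℕ) := by exact_mod_cast h0
        have h2 : (N : ℝ) < B * ((N / B : ℕ) + 1) := by
          exact_mod_cast Nat.lt_mul_div_succ N hB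
        -- Rounding halves the batch size at worst, so a batch has at least `N / (8 L)` samples;
        -- with `N ε ^ 2 ≥ 4096 L` Chebyshev's bound is then at most `16 / 512`.
        have h3 : (N : ℝ) ≤ 8 * L * (N / B : ℕ) := by
          calc (N : ℝ) ≤ B * ((N / B : ℕ) + 1) := h2.le
            _ ≤ (4 * L) * ((N / B : ℕ) + (N / B : ℕ)) := by gcongr
            _ = _ := by ring
        have h4 : 4096 * L ≤ 8 * L * ((N / B : ℕ) * ε ^ 2) := by
          calc _ ≤ _ := hN
            _ ≤ 8 * L * (N / B : ℕ) * ε ^ 2 := by gcongr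
            _ = _ := by ring
        have h5 : 512 ≤ ((N / B : ℕ) * ε ^ 2) := by
          have : (8 * L) * 512 ≤ 8 * L * ((N / B : ℕ) * ε ^ 2) := by linarith
          exact le_of_mul_le_mul_left this (by linarith)
        rw [div_le_div_iff₀ (by linarith) (by norm_num)]
        linarith
      · rw [← Real.exp_nat_mul]
        gcongr
        push_cast
        linarith
  · rw [hT, hL, exp_neg_log_div hK hδ]
    have hx : δ / (2 * K) ≤ 1 / 2 := by
      rw [div_le_div_iff₀ (by positivity) (by positivity)]; nlinarith
    have hδK : (2 * K : ℝ) * (δ / (2 * K)) = δ := by field_simp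
    push_cast
    calc (2 * K : ℝ) * ((δ / (2 * K)) ^ 2)
        = ((2 * K : ℝ) * (δ / (2 * K))) * (δ / (2 * K)) := by ring
      _ ≤ δ * (1 / 2) := by rw [hδK]; gcongr
      _ = δ / 2 := by ring

end Concentration

section Shadows

variable {n : ℕ}

/-! ### Pauli strings -/

/-- The sign `(-1)^z` of a bit `z`. -/
noncomputable def bitSign (z : ZMod 2) : ℂ := (-1) ^ z.val

@[simp] theorem bitSign_zero : bitSign 0 = 1 := by simp [bitSign]

@[simp] theorem bitSign_one : bitSign 1 = -1 := by
  change (-1 : ℂ) ^ 1 = -1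
  norm_num

theorem zmod_two_cases (z : ZMod 2) : z = 0 ∨ z = 1 := by
  revert z; decide

theorem bitSign_add (y z : ZMod 2) : bitSign (y + z) = bitSign y * bitSign z := by
  rcases zmod_two_cases y with rfl | rfl <;> rcases zmod_two_cases z with rfl | rfl <;>
    simp [show (1 + 1 : ZMod 2) = 0 from rfl]

theorem bitSign_mul_self (z : ZMod 2) : bitSign z * bitSign z = 1 := by
  rw [← bitSign_add, CharTwo.add_self_eq_zero, bitSign_zero]

theorem star_bitSign (z : ZMod 2) : star (bitSign z) = bitSign z := by
  simp [bitSign]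

theorem bitSign_sum {ι : Type} (s : Finset ι) (f : ι → ZMod 2) :
    bitSign (∑ i ∈ s, f i) = ∏ i ∈ s, bitSign (f i) := by
  classical
  induction s using Finset.induction_on with
  | empty => simp
  | insert i s hi ih => rw [Finset.sum_insert hi, Finset.prod_insert hi, bitSign_add, ih]

theorem pauliSign_eq_bitSign {n : ℕ} (b y : Qubits n) : pauliSign b y = bitSign (b ⬝ᵥ y) :=
  (bitSign_sum _ _).symm

/-- Labels of Pauli strings: `(a, b)` stands for `X^a Z^b`. -/
abbrev PauliLabel (n : ℕ) : Type := Qubits n × Qubits n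

/-- The Pauli string with a given label. -/
noncomputable def pauli {n : ℕ} (u : PauliLabel n) : Matrix (Qubits n) (Qubits n) ℂ :=
  pauliString u.1 u.2

/-- The symplectic form on labels; it is `0` exactly when the two Pauli strings commute. -/
def sympForm {n : ℕ} (u v : PauliLabel n) : ZMod 2 := u.2 ⬝ᵥ v.1 + v.2 ⬝ᵥ u.1

theorem label_add_self (u : PauliLabel n) : u + u = 0 := by
  ext i <;> exact CharTwo.add_self_eq_zero _

theorem label_add_add_cancel (u v : PauliLabel n) : u + (u + v) = v := by
  rw [← add_assoc, label_add_self, zero_add]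

theorem label_add_eq_zero {u v : PauliLabel n} : u + v = 0 ↔ u = v := by
  constructor
  · intro h
    rw [← label_add_add_cancel u v, h, add_zero]
  · rintro rfl
    exact label_add_self u

theorem sympForm_comm (u v : PauliLabel n) : sympForm u v = sympForm v u := add_comm _ _

theorem sympForm_self (u : PauliLabel n) : sympForm u u = 0 := CharTwo.add_self_eq_zero _

theorem sympForm_add_left (u v w : PauliLabel n) :
    sympForm (u + v) w = sympForm u w + sympForm v w := by
  simp only [sympForm, Prod.fst_add, Prod.snd_add, add_dotProduct, dotProduct_add]
  abel

theorem sympForm_add_right (u v w : PauliLabel n) :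
    sympForm u (v + w) = sympForm u v + sympForm u w := by
  rw [sympForm_comm, sympForm_add_left, sympForm_comm v, sympForm_comm w]

@[simp] theorem sympForm_zero_right (u : PauliLabel n) : sympForm u 0 = 0 := by
  simp [sympForm]

/-- The symplectic form is nondegenerate. -/
theorem exists_sympForm_eq_one {u : PauliLabel n} (hu : u ≠ 0) : ∃ x, sympForm x u = 1 := by
  have h : u.1 ≠ 0 ∨ u.2 ≠ 0 := by
    by_contra! h
    exact hu (Prod.ext h.1 h.2)
  rcases h with h | h
  · obtain ⟨i, hi⟩ := Function.ne_iff.1 h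
    refine ⟨(0, Pi.single i 1), ?_⟩
    simpa [sympForm] using (zmod_two_cases (u.1 i)).resolve_left hi
  · obtain ⟨i, hi⟩ := Function.ne_iff.1 h
    refine ⟨(Pi.single i 1, 0), ?_⟩
    simpa [sympForm] using (zmod_two_cases (u.2 i)).resolve_left hi

theorem exists_sympForm_eq_zero_and_eq_one {u v : PauliLabel n} (hv : v ≠ 0) (hvu : v ≠ u) :
    ∃ x, sympForm x u = 0 ∧ sympForm x v = 1 := by
  obtain ⟨p, hp⟩ := exists_sympForm_eq_one hv
  rcases zmod_two_cases (sympForm p u) with hpu | hpu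
  · exact ⟨p, hpu, hp⟩
  obtain ⟨q, hq⟩ := exists_sympForm_eq_one (fun h => hvu (label_add_eq_zero.1 h))
  rw [sympForm_add_right] at hq
  rcases zmod_two_cases (sympForm q u) with hqu | hqu
  · exact ⟨q, hqu, by simpa [hqu] using hq⟩
  · have hqv : sympForm q v = 0 := by
      rw [hqu] at hq
      simpa using hq
    refine ⟨p + q, ?_, ?_⟩
    · rw [sympForm_add_left, hpu, hqu]; rfl
    · rw [sympForm_add_left, hp, hqv, add_zero]

/-- Transvections that fix `u` act transitively on the labels outside `{0, u}` that are orthogonal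
to `u`: this is Witt's theorem for orthogonal pairs, and for single vectors when `u = 0`. -/
theorem eq_of_transvection_invariant {X : Type} {u : PauliLabel n} {H : PauliLabel n → X}
    (hH : ∀ v x, sympForm x u = 0 → sympForm x v = 1 → H (v + x) = H v) {v w : PauliLabel n}
    (hv : v ≠ 0) (hvu : v ≠ u) (hv0 : sympForm v u = 0) (hw : w ≠ 0) (hwu : w ≠ u)
    (hw0 : sympForm w u = 0) : H v = H w := by
  have step : ∀ v w, sympForm v u = 0 → sympForm w u = 0 → sympForm v w = 1 → H v = H w := by
    intro v w hv hw hvw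
    have h := hH v (v + w) (by rw [sympForm_add_left, hv, hw, add_zero])
      (by rw [sympForm_add_left, sympForm_self, zero_add, sympForm_comm, hvw])
    rw [← h, label_add_add_cancel]
  obtain ⟨p, hpu, hpv⟩ := exists_sympForm_eq_zero_and_eq_one hv hvu
  obtain ⟨q, hqu, hqw⟩ := exists_sympForm_eq_zero_and_eq_one hw hwu
  have via : ∀ x, sympForm x u = 0 → sympForm x v = 1 → sympForm x w = 1 → H v = H w :=
    fun x hxu hxv hxw =>
      (step v x hv0 hxu (by rw [sympForm_comm, hxv])).trans (step x w hxu hw0 hxw)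
  rcases zmod_two_cases (sympForm p w) with hpw | hpw
  · rcases zmod_two_cases (sympForm q v) with hqv | hqv
    · refine via (p + q) ?_ ?_ ?_
      · rw [sympForm_add_left, hpu, hqu, add_zero]
      · rw [sympForm_add_left, hpv, hqv, add_zero]
      · rw [sympForm_add_left, hpw, hqw, zero_add]
    · exact via q hqu hqv hqw
  · exact via p hpu hpv hpw

theorem sum_bitSign_sympForm {u : PauliLabel n} (hu : u ≠ 0) :
    ∑ v, bitSign (sympForm u v) = 0 := by
  obtain ⟨x, hx⟩ := exists_sympForm_eq_one hu
  have h := Equiv.sum_comp (Equiv.addRight x) fun v => bitSign (sympForm u v)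
  simp only [Equiv.coe_addRight, sympForm_add_right, bitSign_add, sympForm_comm u x, hx,
    bitSign_one, mul_neg_one, Finset.sum_neg_distrib] at h
  exact CharZero.neg_eq_self_iff.1 h

theorem card_qubits : (Fintype.card (Qubits n) : ℂ) = 2 ^ n := by
  simp [ZMod.card]

theorem pauli_mul (u v : PauliLabel n) :
    pauli u * pauli v = bitSign (u.2 ⬝ᵥ v.1) • pauli (u + v) := by
  ext x y
  simp only [pauli, pauliString, Matrix.mul_apply, Matrix.of_apply, Matrix.smul_apply,
    pauliSign_eq_bitSign, mul_ite, mul_zero, smul_eq_mul, Finset.sum_ite_eq',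
    Finset.mem_univ, if_true, Prod.fst_add, Prod.snd_add, ite_mul, zero_mul]
  have h : x = y + v.1 + u.1 ↔ x = y + (u.1 + v.1) := by
    rw [add_assoc, add_comm v.1]
  simp only [h]
  split_ifs with hx
  · rw [dotProduct_add, add_dotProduct, bitSign_add, bitSign_add]
    ring
  · rfl

@[simp] theorem pauli_zero : pauli (0 : PauliLabel n) = 1 := by
  ext x y
  simp [pauli, pauliString, pauliSign_eq_bitSign, Matrix.one_apply]

theorem star_pauli (u : PauliLabel n) : star (pauli u) = bitSign (u.2 ⬝ᵥ u.1) • pauli u := by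
  ext x y
  simp only [Matrix.star_apply, pauli, pauliString, Matrix.of_apply, Matrix.smul_apply,
    smul_eq_mul, pauliSign_eq_bitSign]
  have h : y = x + u.1 ↔ x = y + u.1 := by
    have : u.1 + u.1 = 0 := by ext i; exact CharTwo.add_self_eq_zero _
    constructor <;> rintro rfl <;> rw [add_assoc, this, add_zero]
  simp only [h]
  split_ifs with hx
  · rw [star_bitSign, hx, dotProduct_add, bitSign_add, mul_comm]
  · simp

theorem pauli_mul_star_self (u : PauliLabel n) : pauli u * star (pauli u) = 1 := by
  rw [star_pauli, mul_smul_comm, pauli_mul, label_add_self, smul_smul, bitSign_mul_self, one_smul,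
    pauli_zero]

theorem star_pauli_mul_self (u : PauliLabel n) : star (pauli u) * pauli u = 1 := by
  rw [star_pauli, smul_mul_assoc, pauli_mul, label_add_self, smul_smul, bitSign_mul_self, one_smul,
    pauli_zero]

/-- Two Pauli strings commute or anticommute, according to the symplectic form. -/
theorem pauli_mul_comm (u v : PauliLabel n) :
    pauli u * pauli v = bitSign (sympForm u v) • (pauli v * pauli u) := by
  rw [pauli_mul, pauli_mul, smul_smul, add_comm v u, sympForm, bitSign_add, mul_assoc,
    bitSign_mul_self, mul_one]

theorem trace_pauli (u : PauliLabel n) : (pauli u).trace = if u = 0 then (2 : ℂ) ^ n else 0 := by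
  split_ifs with hu
  · rw [hu, pauli_zero, Matrix.trace_one, card_qubits]
  · -- conjugation by an anticommuting Pauli string changes the sign of the trace
    obtain ⟨x, hx⟩ := exists_sympForm_eq_one hu
    have h : (pauli x * pauli u * star (pauli x)).trace = (pauli u).trace := by
      rw [Matrix.trace_mul_comm, ← mul_assoc, star_pauli_mul_self, one_mul]
    rw [pauli_mul_comm, hx, bitSign_one, smul_mul_assoc, mul_assoc, pauli_mul_star_self, mul_one,
      Matrix.trace_smul, smul_eq_mul, neg_one_mul] at h
    exact CharZero.neg_eq_self_iff.1 h

/-- Completeness of the Pauli strings. -/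
theorem sum_trace_pauli_smul_star (A : Matrix (Qubits n) (Qubits n) ℂ) :
    ∑ v, (pauli v * A).trace • star (pauli v) = (2 : ℂ) ^ n • A := by
  ext x y
  have htr : ∀ v : PauliLabel n, (pauli v * A).trace = ∑ z, pauliSign v.2 z * A z (z + v.1) := by
    intro v
    simp only [Matrix.trace, Matrix.diag, Matrix.mul_apply, pauli, pauliString, Matrix.of_apply,
      ite_mul, zero_mul]
    rw [Finset.sum_comm]
    simp
  have hst : ∀ v : PauliLabel n, star (pauli v) x y
      = if v.1 = y - x then pauliSign v.2 x else 0 := by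
    intro v
    simp only [Matrix.star_apply, pauli, pauliString, Matrix.of_apply, pauliSign_eq_bitSign]
    have : y = x + v.1 ↔ v.1 = y - x := by rw [eq_sub_iff_add_eq', eq_comm]
    simp only [this]
    split_ifs <;> simp [star_bitSign]
  simp only [Matrix.sum_apply, Matrix.smul_apply, smul_eq_mul, htr, hst, Fintype.sum_prod_type]
  rw [Finset.sum_eq_single (y - x) (fun a _ ha => by simp [ha]) (by simp)]
  simp only [if_true, Finset.sum_mul]
  rw [Finset.sum_comm]
  have : ∀ z b, pauliSign b z * A z (z + (y - x)) * pauliSign b x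
      = pauliSign b z * pauliSign b x * A z (z + (y - x)) := fun z b => by ring
  simp only [this, ← Finset.sum_mul, sum_pauliSign]
  rw [Finset.sum_eq_single x (fun z _ hz => by rw [if_neg (Ne.symm hz), zero_mul]) (by simp)]
  simp

/-- The Pauli strings span the matrix algebra. -/
theorem eq_zero_of_pauli {f : Matrix (Qubits n) (Qubits n) ℂ → ℂ} (hf : IsLinearMap ℂ f)
    (h : ∀ v, f (pauli v) = 0) (A : Matrix (Qubits n) (Qubits n) ℂ) : f A = 0 := by
  have hA := congrArg (hf.mk' f) (sum_trace_pauli_smul_star A)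
  simp only [map_sum, map_smul, star_pauli, IsLinearMap.mk'_apply, h, smul_zero,
    Finset.sum_const_zero] at hA
  exact (smul_eq_zero.1 hA.symm).resolve_left (by positivity)

/-! ### Clifford operations -/

/-- Mapping Pauli strings into the Pauli group is enough to normalise it, because it is finite. -/
theorem mem_cliffordUnitaries {U : unitary (Matrix (Qubits n) (Qubits n) ℂ)}
    (h : ∀ u, Unitary.conjStarAlgAut ℂ _ U (pauli u) ∈ pauliGroup n) :
    U ∈ cliffordUnitaries n := by
  set α := Unitary.conjStarAlgAut ℂ (Matrix (Qubits n) (Qubits n) ℂ) U with hα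
  have hmul : ∀ c : ℂ, c ^ 4 = 1 → ∀ P ∈ pauliGroup n, c • P ∈ pauliGroup n := by
    rintro c hc P ⟨c', a, b, hc', rfl⟩
    exact ⟨c * c', a, b, by rw [mul_pow, hc, hc', one_mul], by rw [smul_smul]⟩
  have hmaps : Set.MapsTo α (pauliGroup n) (pauliGroup n) := by
    rintro P ⟨c, a, b, hc, rfl⟩
    rw [map_smul]
    exact hmul c hc _ (h (a, b))
  have hfin : Finite (pauliGroup n) := pauliGroup_finite n
  have hsurj : Function.Surjective (hmaps.restrict α _ _) :=
    Finite.surjective_of_injective (hmaps.restrict_inj.2 α.injective.injOn)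
  intro P
  refine ⟨fun hP => hmaps hP, fun hP => ?_⟩
  obtain ⟨Q, hQ⟩ := hsurj ⟨α P, hP⟩
  have hQP : α Q = α P := congrArg Subtype.val hQ
  rw [← α.injective hQP]
  exact Q.2

theorem pauli_mem_pauliGroup (u : PauliLabel n) {c : ℂ} (hc : c ^ 4 = 1) :
    c • pauli u ∈ pauliGroup n := ⟨c, u.1, u.2, hc, rfl⟩

theorem bitSign_pow_four (z : ZMod 2) : bitSign z ^ 4 = 1 := by
  rw [show bitSign z ^ 4 = (bitSign z * bitSign z) * (bitSign z * bitSign z) by ring,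
    bitSign_mul_self, one_mul]

/-- Pauli strings are themselves Clifford operations, and act on Pauli strings by signs. -/
theorem exists_clifford_pauli (x : PauliLabel n) :
    ∃ g ∈ cliffordGroup n, ∀ u, g (pauli u) = bitSign (sympForm x u) • pauli u := by
  let U : unitary (Matrix (Qubits n) (Qubits n) ℂ) :=
    ⟨pauli x, Unitary.mem_iff.2 ⟨star_pauli_mul_self x, pauli_mul_star_self x⟩⟩
  have hU : ∀ u, Unitary.conjStarAlgAut ℂ _ U (pauli u) = bitSign (sympForm x u) • pauli u := by
    intro u
    rw [Unitary.conjStarAlgAut_apply]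
    change pauli x * pauli u * star (pauli x) = _
    rw [pauli_mul_comm, smul_mul_assoc, mul_assoc, pauli_mul_star_self, mul_one]
  refine ⟨_, Subgroup.mem_map_of_mem _ (mem_cliffordUnitaries fun u => ?_), hU⟩
  rw [hU]
  exact pauli_mem_pauliGroup u (bitSign_pow_four _)

/-- The Clifford operation `(1 + J) / √2`, where `J` is the anti-Hermitian multiple of a Pauli
string, acts on labels as a symplectic transvection. -/
theorem exists_clifford_transvection (x : PauliLabel n) :
    ∃ g ∈ cliffordGroup n, (∀ u, sympForm x u = 0 → g (pauli u) = pauli u) ∧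
      ∀ u, sympForm x u = 1 → ∃ c : ℂ, c * star c = 1 ∧ g (pauli u) = c • pauli (u + x) := by
  obtain ⟨ζ, hζ4, hζ1, hζ2⟩ : ∃ ζ : ℂ, ζ ^ 4 = 1 ∧ ζ * star ζ = 1 ∧
      star ζ * bitSign (x.2 ⬝ᵥ x.1) = -ζ := by
    rcases zmod_two_cases (x.2 ⬝ᵥ x.1) with h | h
    · exact ⟨Complex.I, by simp, by simp, by simp [h]⟩
    · exact ⟨1, by simp, by simp, by simp [h]⟩
  set J := ζ • pauli x with hJ
  have hstar : star J = -J := by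
    rw [hJ, star_smul, star_pauli, smul_smul, hζ2, neg_smul]
  have hJJ : J * J = -1 := by
    have : J * star J = 1 := by
      rw [hJ, star_smul, smul_mul_smul_comm, hζ1, pauli_mul_star_self, one_smul]
    rw [hstar, mul_neg] at this
    rw [← this, neg_neg]
  set r : ℂ := ((Real.sqrt 2 : ℝ) : ℂ)⁻¹ with hr
  have hrr : r * r = 1 / 2 := by
    rw [hr, ← mul_inv, ← Complex.ofReal_mul, Real.mul_self_sqrt (by norm_num)]
    norm_num
  have hrstar : star r = r := by
    rw [hr, star_inv₀]
    simp
  have hUstar : star (r • (1 + J)) = r • (1 - J) := by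
    rw [star_smul, hrstar, star_add, star_one, hstar, sub_eq_add_neg]
  have hmul : ∀ A B : Matrix (Qubits n) (Qubits n) ℂ, (r • A) * (r • B) = (1 / 2 : ℂ) • (A * B) :=
    fun A B => by rw [smul_mul_smul_comm, hrr]
  have htwo : (1 : Matrix (Qubits n) (Qubits n) ℂ) + 1 = (2 : ℂ) • 1 := by
    rw [two_smul]
  have h1 : (1 + J) * (1 - J) = (2 : ℂ) • 1 := by
    rw [← htwo, add_mul, mul_sub, mul_sub, hJJ]; simp only [one_mul, mul_one]; abel
  have h2 : (1 - J) * (1 + J) = (2 : ℂ) • 1 := by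
    rw [← htwo, sub_mul, mul_add, mul_add, hJJ]; simp only [one_mul, mul_one]; abel
  let U : unitary (Matrix (Qubits n) (Qubits n) ℂ) :=
    ⟨r • (1 + J), Unitary.mem_iff.2 ⟨by rw [hUstar, hmul, h2, smul_smul]; norm_num,
      by rw [hUstar, hmul, h1, smul_smul]; norm_num⟩⟩
  have hconj : ∀ A, Unitary.conjStarAlgAut ℂ _ U A = (1 / 2 : ℂ) • ((1 + J) * A * (1 - J)) := by
    intro A
    rw [Unitary.conjStarAlgAut_apply]
    change r • (1 + J) * A * star (r • (1 + J)) = _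
    rw [hUstar, smul_mul_assoc, hmul]
  have hcomm : ∀ u, sympForm x u = 0 → Unitary.conjStarAlgAut ℂ _ U (pauli u) = pauli u := by
    intro u hu
    have hc : pauli u * J = J * pauli u := by
      rw [hJ, mul_smul_comm, smul_mul_assoc, pauli_mul_comm x, hu, bitSign_zero, one_smul]
    rw [hconj, mul_assoc, mul_sub, mul_one, hc,
      show pauli u - J * pauli u = (1 - J) * pauli u by rw [sub_mul, one_mul], ← mul_assoc, h1,
      smul_mul_assoc, one_mul, smul_smul]
    norm_num
  have hanti : ∀ u, sympForm x u = 1 → Unitary.conjStarAlgAut ℂ _ U (pauli u)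
      = (ζ * bitSign (x.2 ⬝ᵥ u.1)) • pauli (u + x) := by
    intro u hu
    have hc : pauli u * J = -(J * pauli u) := by
      rw [hJ, mul_smul_comm, smul_mul_assoc, pauli_mul_comm x, hu, bitSign_one,
        neg_one_smul, smul_neg, neg_neg]
    have hsq : (1 + J) * (1 + J) = (2 : ℂ) • J := by
      rw [two_smul, add_mul, mul_add, mul_add, hJJ]
      simp only [one_mul, mul_one]
      abel
    rw [hconj, mul_assoc, mul_sub, mul_one, hc, sub_neg_eq_add,
      show pauli u + J * pauli u = (1 + J) * pauli u by rw [add_mul, one_mul], ← mul_assoc, hsq,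
      smul_mul_assoc, smul_smul, hJ, smul_mul_assoc, pauli_mul, smul_smul, smul_smul, add_comm x u]
    norm_num
  refine ⟨_, Subgroup.mem_map_of_mem _ (mem_cliffordUnitaries (U := U) fun u => ?_), hcomm,
    fun u hu => ⟨_, ?_, hanti u hu⟩⟩
  · rcases zmod_two_cases (sympForm x u) with hu | hu
    · rw [hcomm u hu, ← one_smul ℂ (pauli u)]
      exact pauli_mem_pauliGroup u (one_pow 4)
    · rw [hanti u hu]
      exact pauli_mem_pauliGroup _ (by rw [mul_pow, hζ4, bitSign_pow_four, one_mul])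
  · rw [star_mul, star_bitSign, show ∀ a b c : ℂ, a * b * (b * c) = a * c * (b * b) by
      intros; ring, hζ1, bitSign_mul_self, one_mul]

/-! ### The Clifford group is a unitary 3-design -/

/-- The third moment `E_g ⟨b|gAg†|b⟩⟨b|gBg†|b⟩⟨b|gCg†|b⟩` over the Clifford group. -/
noncomputable def cliffordMoment (b : Qubits n) (A B C : Matrix (Qubits n) (Qubits n) ℂ) : ℂ :=
  (Fintype.card (cliffordGroup n) : ℂ)⁻¹ *
    ∑ g : cliffordGroup n, g.1 A b b * g.1 B b b * g.1 C b b

/-- The unnormalised symmetric invariant `∑_π tr_π(A, B, C)`, summed over the permutations of three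
tensor factors. -/
noncomputable def symTrace (A B C : Matrix (Qubits n) (Qubits n) ℂ) : ℂ :=
  A.trace * B.trace * C.trace + (A * B).trace * C.trace + (A * C).trace * B.trace
    + (B * C).trace * A.trace + (A * B * C).trace + (A * C * B).trace

theorem cliffordMoment_map (b : Qubits n) {h : Matrix (Qubits n) (Qubits n) ℂ ≃⋆ₐ[ℂ]
      Matrix (Qubits n) (Qubits n) ℂ} (hh : h ∈ cliffordGroup n)
    (A B C : Matrix (Qubits n) (Qubits n) ℂ) :
    cliffordMoment b (h A) (h B) (h C) = cliffordMoment b A B C := by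
  unfold cliffordMoment
  congr 1
  exact Equiv.sum_comp (Equiv.mulRight (⟨h, hh⟩ : cliffordGroup n))
    fun g : cliffordGroup n => g.1 A b b * g.1 B b b * g.1 C b b

theorem cliffordMoment_swap_left (b : Qubits n) (A B C : Matrix (Qubits n) (Qubits n) ℂ) :
    cliffordMoment b A B C = cliffordMoment b B A C := by
  simp only [cliffordMoment, mul_comm]

theorem cliffordMoment_swap_right (b : Qubits n) (A B C : Matrix (Qubits n) (Qubits n) ℂ) :
    cliffordMoment b A B C = cliffordMoment b A C B := by
  simp only [cliffordMoment, mul_right_comm]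

theorem cliffordMoment_smul (b : Qubits n) (x y z : ℂ) (A B C : Matrix (Qubits n) (Qubits n) ℂ) :
    cliffordMoment b (x • A) (y • B) (z • C) = x * y * z * cliffordMoment b A B C := by
  simp only [cliffordMoment, map_smul, Matrix.smul_apply, smul_eq_mul, Finset.mul_sum]
  exact Finset.sum_congr rfl fun g _ => by ring

theorem cliffordMoment_one (b : Qubits n) : cliffordMoment b 1 1 1 = 1 := by
  simp [cliffordMoment]

theorem isLinearMap_cliffordMoment (b : Qubits n) (A B : Matrix (Qubits n) (Qubits n) ℂ) :
    IsLinearMap ℂ (cliffordMoment b A B) where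
  map_add C D := by
    simp only [cliffordMoment, map_add, Matrix.add_apply, mul_add, Finset.sum_add_distrib]
  map_smul c C := by
    have := cliffordMoment_smul b 1 1 c A B C
    simpa using this

theorem isLinearMap_symTrace (A B : Matrix (Qubits n) (Qubits n) ℂ) :
    IsLinearMap ℂ (symTrace A B) where
  map_add C D := by
    simp only [symTrace, Matrix.trace_add, mul_add, add_mul]
    ring
  map_smul c C := by
    simp only [symTrace, Matrix.trace_smul, mul_smul_comm, smul_mul_assoc, smul_eq_mul]
    ring

theorem symTrace_swap_left (A B C : Matrix (Qubits n) (Qubits n) ℂ) :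
    symTrace A B C = symTrace B A C := by
  simp only [symTrace]
  rw [Matrix.trace_mul_cycle A B C, Matrix.trace_mul_cycle A C B, Matrix.trace_mul_comm A B,
    Matrix.trace_mul_cycle C A B, Matrix.trace_mul_cycle B A C]
  ring

theorem symTrace_swap_right (A B C : Matrix (Qubits n) (Qubits n) ℂ) :
    symTrace A B C = symTrace A C B := by
  simp only [symTrace]
  rw [Matrix.trace_mul_comm B C]
  ring

theorem symTrace_map (h : Matrix (Qubits n) (Qubits n) ℂ ≃⋆ₐ[ℂ] Matrix (Qubits n) (Qubits n) ℂ)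
    (A B C : Matrix (Qubits n) (Qubits n) ℂ) : symTrace (h A) (h B) (h C) = symTrace A B C := by
  have htr : ∀ X, (h X).trace = X.trace := fun X => Matrix.trace_map h.toAlgEquiv X
  simp only [symTrace, ← map_mul, htr]

/-- A form that is linear in the last argument and invariant under the Pauli group vanishes on
Pauli strings whose product is not a scalar. -/
theorem eq_zero_of_pauli_invariant
    {F : Matrix (Qubits n) (Qubits n) ℂ → Matrix (Qubits n) (Qubits n) ℂ →
      Matrix (Qubits n) (Qubits n) ℂ → ℂ}
    (hF : ∀ h ∈ cliffordGroup n, ∀ A B C, F (h A) (h B) (h C) = F A B C)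
    (hs : ∀ (x y z : ℂ) A B C, F (x • A) (y • B) (z • C) = x * y * z * F A B C)
    {u v w : PauliLabel n} (hw : u + v ≠ w) : F (pauli u) (pauli v) (pauli w) = 0 := by
  obtain ⟨x, hx⟩ := exists_sympForm_eq_one fun h => hw (label_add_eq_zero.1 h)
  obtain ⟨h, hh, hact⟩ := exists_clifford_pauli x
  have := hF h hh (pauli u) (pauli v) (pauli w)
  rw [hact, hact, hact, hs, ← bitSign_add, ← bitSign_add, ← sympForm_add_right,
    ← sympForm_add_right, hx, bitSign_one, neg_one_mul] at this
  exact CharZero.neg_eq_self_iff.1 this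

theorem star_pauli_mul (u v : PauliLabel n) :
    ∃ c : ℂ, star (pauli u * pauli v) = c • pauli (u + v) := by
  rw [pauli_mul, star_smul, star_pauli, smul_smul]
  exact ⟨_, rfl⟩

/-- The moment on the Pauli strings `P_u`, `P_v` and `(P_u P_v)†`; the phases of a Clifford
operation cancel in it. -/
noncomputable def pauliMoment (b : Qubits n) (u v : PauliLabel n) : ℂ :=
  cliffordMoment b (pauli u) (pauli v) (star (pauli u * pauli v))

theorem pauliMoment_zero_zero (b : Qubits n) : pauliMoment b 0 0 = 1 := by
  simp [pauliMoment, cliffordMoment_one]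

theorem pauliMoment_comm (b : Qubits n) (u v : PauliLabel n) :
    pauliMoment b u v = bitSign (sympForm u v) * pauliMoment b v u := by
  rw [pauliMoment, cliffordMoment_swap_left, pauli_mul_comm, star_smul, star_bitSign]
  have := cliffordMoment_smul b 1 1 (bitSign (sympForm u v)) (pauli v) (pauli u)
    (star (pauli v * pauli u))
  simpa [pauliMoment] using this

theorem pauliMoment_self (b : Qubits n) (u : PauliLabel n) :
    pauliMoment b u u = pauliMoment b u 0 := by
  set s := bitSign (u.2 ⬝ᵥ u.1) with hs
  have hsq : pauli u * pauli u = s • 1 := by rw [pauli_mul, label_add_self, pauli_zero]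
  have hst : pauli u = s • star (pauli u) := by
    rw [star_pauli, smul_smul, bitSign_mul_self, one_smul]
  have hss : s * s = 1 := bitSign_mul_self _
  have h1 : star (pauli u * pauli u) = s • 1 := by rw [hsq, star_smul, star_bitSign, star_one]
  calc pauliMoment b u u
      = cliffordMoment b ((1 : ℂ) • pauli u) (s • star (pauli u)) (s • 1) := by
        rw [pauliMoment, h1, ← hst, one_smul]
    _ = pauliMoment b u 0 := by
        rw [cliffordMoment_smul, one_mul, hss, one_mul, cliffordMoment_swap_right, pauliMoment,
          pauli_zero, mul_one]

theorem pauliMoment_eq_of_map (b : Qubits n) {h : Matrix (Qubits n) (Qubits n) ℂ ≃⋆ₐ[ℂ]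
      Matrix (Qubits n) (Qubits n) ℂ} (hh : h ∈ cliffordGroup n) {u v u' v' : PauliLabel n}
    {c c' : ℂ} (hc : c * star c = 1) (hc' : c' * star c' = 1) (hu : h (pauli u) = c • pauli u')
    (hv : h (pauli v) = c' • pauli v') : pauliMoment b u' v' = pauliMoment b u v := by
  have := cliffordMoment_map b hh (pauli u) (pauli v) (star (pauli u * pauli v))
  rw [map_star, map_mul, hu, hv, smul_mul_smul_comm, star_smul, cliffordMoment_smul, star_mul',
    show c * c' * (star c * star c') = (c * star c) * (c' * star c') by ring, hc, hc', one_mul,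
    one_mul] at this
  exact this

theorem pauliMoment_transvection (b : Qubits n) {u v x : PauliLabel n} (hu : sympForm x u = 0)
    (hv : sympForm x v = 1) : pauliMoment b u (v + x) = pauliMoment b u v := by
  obtain ⟨h, hh, h0, h1⟩ := exists_clifford_transvection x
  obtain ⟨c, hc, hcv⟩ := h1 v hv
  exact pauliMoment_eq_of_map b hh (c := 1) (by simp) hc (by rw [h0 u hu, one_smul]) hcv

theorem pauliMoment_zero_left (b : Qubits n) (u : PauliLabel n) :
    pauliMoment b 0 u = pauliMoment b u 0 := by
  rw [pauliMoment_comm, sympForm_comm, sympForm_zero_right, bitSign_zero, one_mul]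

/-- The transvection along `u + v` exchanges anticommuting `P_u` and `P_v`, while exchanging the
arguments changes the sign. -/
theorem pauliMoment_of_anticommute (b : Qubits n) {u v : PauliLabel n} (h : sympForm u v = 1) :
    pauliMoment b u v = 0 := by
  obtain ⟨g, hg, -, hact⟩ := exists_clifford_transvection (u + v)
  obtain ⟨c, hc, hu⟩ := hact u (by
    rw [sympForm_add_left, sympForm_self, zero_add, sympForm_comm, h])
  obtain ⟨c', hc', hv⟩ := hact v (by rw [sympForm_add_left, sympForm_self, add_zero, h])
  rw [label_add_add_cancel] at hu
  rw [add_comm u v, label_add_add_cancel] at hv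
  have h1 := pauliMoment_eq_of_map b hg hc hc' hu hv
  rw [pauliMoment_comm b u v, h, bitSign_one, neg_one_mul] at h1 ⊢
  rw [CharZero.eq_neg_self_iff.1 h1, neg_zero]

/-- Diagonal entries in the Heisenberg picture: `⟨b|g(A)|b⟩ = tr(A g⁻¹(|b⟩⟨b|))`. -/
theorem apply_diag_eq_trace {ι : Type} [Fintype ι] [DecidableEq ι]
    (g : Matrix ι ι ℂ ≃⋆ₐ[ℂ] Matrix ι ι ℂ) (A : Matrix ι ι ℂ) (b : ι) :
    g A b b = (A * g.symm (Matrix.single b b 1)).trace := by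
  have h1 : (g (A * g.symm (Matrix.single b b 1))).trace
      = (A * g.symm (Matrix.single b b 1)).trace :=
    Matrix.trace_map g.toAlgEquiv _
  rw [← h1, map_mul, StarAlgEquiv.apply_symm_apply, Matrix.trace_mul_single]
  simp

/-- Summing over `v` uses the purity of the state `g⁻¹(|b⟩⟨b|)`. -/
theorem sum_pauliMoment (b : Qubits n) (u : PauliLabel n) :
    ∑ v, pauliMoment b u v = 2 ^ n * pauliMoment b u 0 := by
  have htr : ∀ (g : cliffordGroup n) (A : Matrix (Qubits n) (Qubits n) ℂ),
      g.1 A b b = (A * g.1.symm (Matrix.single b b 1)).trace :=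
    fun g A => apply_diag_eq_trace g.1 A b
  have hidem : ∀ g : cliffordGroup n, g.1.symm (Matrix.single b b 1) *
      g.1.symm (Matrix.single b b 1) = g.1.symm (Matrix.single b b (1 : ℂ)) := by
    intro g
    rw [← map_mul, Matrix.single_mul_single_same, one_mul]
  have key : ∀ g : cliffordGroup n, ∑ v, g.1 (pauli v) b b * g.1 (star (pauli u * pauli v)) b b
      = 2 ^ n * g.1 (star (pauli u)) b b := by
    intro g
    set E := g.1.symm (Matrix.single b b (1 : ℂ)) with hE
    calc ∑ v, g.1 (pauli v) b b * g.1 (star (pauli u * pauli v)) b b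
        = ((∑ v, (pauli v * E).trace • star (pauli v)) * (star (pauli u) * E)).trace := by
          rw [Finset.sum_mul, Matrix.trace_sum]
          refine Finset.sum_congr rfl fun v _ => ?_
          rw [htr, htr, star_mul, smul_mul_assoc, Matrix.trace_smul, smul_eq_mul, mul_assoc]
      _ = 2 ^ n * g.1 (star (pauli u)) b b := by
          rw [sum_trace_pauli_smul_star, smul_mul_assoc, Matrix.trace_smul, smul_eq_mul,
            ← mul_assoc E, Matrix.trace_mul_comm, ← mul_assoc, hidem, Matrix.trace_mul_comm, htr]
  simp only [pauliMoment, cliffordMoment, pauli_zero, mul_one, map_one, Matrix.one_apply_eq]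
  rw [← Finset.mul_sum, Finset.sum_comm, mul_left_comm]
  congr 1
  rw [Finset.mul_sum]
  refine Finset.sum_congr rfl fun g _ => ?_
  simp only [mul_assoc]
  rw [← Finset.mul_sum, key]
  ring

theorem sum_label_one : ∑ _v : PauliLabel n, (1 : ℂ) = 2 ^ n * 2 ^ n := by
  rw [Finset.sum_const, Finset.card_univ, Fintype.card_prod, nsmul_eq_mul, mul_one, Nat.cast_mul,
    card_qubits]

/-- All moments with one nontrivial Pauli string agree, and they sum to `d - 1`. -/
theorem pauliMoment_zero_right (b : Qubits n) {u : PauliLabel n} (hu : u ≠ 0) :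
    (2 ^ n + 1) * pauliMoment b u 0 = 1 := by
  have hn : n ≠ 0 := by
    rintro rfl
    exact hu (Subsingleton.elim _ _)
  have hconst : ∀ v, pauliMoment b 0 v
      = (if v = 0 then 1 - pauliMoment b u 0 else 0) + 1 * pauliMoment b u 0 := by
    intro v
    by_cases hv : v = 0
    · rw [hv, if_pos rfl, pauliMoment_zero_zero]; ring
    · rw [if_neg hv, zero_add, one_mul, ← pauliMoment_zero_left]
      exact eq_of_transvection_invariant (u := 0)
        (fun v x hx0 hxv => pauliMoment_transvection b hx0 hxv) hv hv (by simp) hu hu (by simp)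
  have hsum := sum_pauliMoment b (0 : PauliLabel n)
  simp only [hconst] at hsum
  rw [Finset.sum_add_distrib, Finset.sum_ite_eq' Finset.univ, if_pos (Finset.mem_univ _),
    ← Finset.sum_mul, sum_label_one, if_pos trivial] at hsum
  have hd : (2 : ℂ) ^ n - 1 ≠ 0 := by
    rw [sub_ne_zero]
    exact_mod_cast (Nat.one_lt_two_pow hn).ne'
  apply mul_left_cancel₀ hd
  linear_combination hsum

theorem sympForm_eq_one_of_one_qubit (u v : PauliLabel 1) (hu : u ≠ 0) (hv : v ≠ 0)
    (huv : v ≠ u) : sympForm u v = 1 := by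
  revert u v
  decide

/-- For fixed `u` the moments of the commuting independent `v` agree; as the anticommuting ones
vanish, `sum_pauliMoment` determines their value. -/
theorem pauliMoment_of_commute (b : Qubits n) {u v : PauliLabel n} (hu : u ≠ 0) (hv : v ≠ 0)
    (hvu : v ≠ u) (h : sympForm v u = 0) :
    (2 ^ n + 1) * (2 ^ n + 2) * pauliMoment b u v = 2 := by
  -- On one qubit no two distinct Pauli matrices commute; on more, `d ^ 2 - 4` does not vanish.
  have hn : 2 ≤ n := by
    by_contra! hlt
    interval_cases n
    · exact hu (Subsingleton.elim _ _)
    · rw [sympForm_eq_one_of_one_qubit v u hv hu (Ne.symm hvu)] at h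
      exact one_ne_zero h
  set τ := pauliMoment b u v with hτ
  set κ := pauliMoment b u 0 with hκ
  have hconst : ∀ w, pauliMoment b u w = (if w = 0 then κ - τ else 0)
      + (if w = u then κ - τ else 0) + (1 * (τ / 2) + bitSign (sympForm u w) * (τ / 2)) := by
    intro w
    by_cases hw : w = 0
    · rw [hw, if_pos rfl, if_neg (Ne.symm hu), sympForm_zero_right, bitSign_zero]
      ring
    by_cases hwu : w = u
    · rw [hwu, if_pos rfl, if_neg hu, sympForm_self, bitSign_zero, pauliMoment_self]
      ring
    rw [if_neg hw, if_neg hwu]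
    rcases zmod_two_cases (sympForm u w) with h0 | h1
    · rw [h0, bitSign_zero, eq_of_transvection_invariant (u := u)
        (fun v x hx0 hxv => pauliMoment_transvection b hx0 hxv) hw hwu
        (by rw [sympForm_comm, h0]) hv hvu h]
      ring
    · rw [h1, bitSign_one, pauliMoment_of_anticommute b h1]
      ring
  have hsum := sum_pauliMoment b u
  simp only [hconst] at hsum
  rw [Finset.sum_add_distrib, Finset.sum_add_distrib, Finset.sum_add_distrib,
    Finset.sum_ite_eq' Finset.univ, Finset.sum_ite_eq' Finset.univ, if_pos (Finset.mem_univ _),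
    if_pos (Finset.mem_univ _), ← Finset.sum_mul, ← Finset.sum_mul, sum_label_one,
    sum_bitSign_sympForm hu, if_pos trivial, if_neg (Ne.symm hu), sympForm_zero_right,
    bitSign_zero] at hsum
  have hκ1 : (2 ^ n + 1) * κ = 1 := pauliMoment_zero_right b hu
  have hd : (2 : ℂ) ^ n - 2 ≠ 0 := by
    rw [sub_ne_zero]
    have : 2 ^ 1 < 2 ^ n := Nat.pow_lt_pow_right (by norm_num) hn
    exact_mod_cast this.ne'
  apply mul_left_cancel₀ hd
  linear_combination 2 * (2 ^ n + 1) * hsum + (2 * 2 ^ n - 4) * hκ1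

theorem symTrace_pauli (u v : PauliLabel n) :
    symTrace (pauli u) (pauli v) (star (pauli u * pauli v))
      = (if u = 0 ∧ v = 0 then (2 ^ n) ^ 3 else 0) + (if u = v then (2 ^ n) ^ 2 else 0)
        + (if v = 0 then (2 ^ n) ^ 2 else 0) + (if u = 0 then (2 ^ n) ^ 2 else 0)
        + 2 ^ n + bitSign (sympForm u v) * 2 ^ n := by
  have hstar : ∀ w : PauliLabel n, (star (pauli w)).trace = if w = 0 then (2 : ℂ) ^ n else 0 := by
    intro w
    rw [star_pauli, Matrix.trace_smul, trace_pauli]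
    split_ifs with h
    · simp [h]
    · simp
  have hC : star (pauli u * pauli v) = star (pauli v) * star (pauli u) := star_mul _ _
  have h1 : (pauli u).trace * (pauli v).trace * (star (pauli u * pauli v)).trace
      = if u = 0 ∧ v = 0 then ((2 : ℂ) ^ n) ^ 3 else 0 := by
    rw [trace_pauli, trace_pauli]
    by_cases hu : u = 0 <;> by_cases hv : v = 0 <;> simp [hu, hv]
    ring
  have h2 : (pauli u * pauli v).trace * (star (pauli u * pauli v)).trace
      = if u = v then ((2 : ℂ) ^ n) ^ 2 else 0 := by
    rw [pauli_mul, star_smul, Matrix.trace_smul, Matrix.trace_smul, hstar, trace_pauli,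
      star_bitSign, smul_eq_mul]
    simp only [label_add_eq_zero]
    split_ifs
    · linear_combination ((2 : ℂ) ^ n) ^ 2 * bitSign_mul_self (u.2 ⬝ᵥ v.1)
    · simp
  have h3 : (pauli u * star (pauli u * pauli v)).trace * (pauli v).trace
      = if v = 0 then ((2 : ℂ) ^ n) ^ 2 else 0 := by
    rw [trace_pauli]
    split_ifs with hv
    · rw [hv, pauli_zero, mul_one, pauli_mul_star_self, Matrix.trace_one, card_qubits, sq]
    · simp
  have h4 : (pauli v * star (pauli u * pauli v)).trace * (pauli u).trace
      = if u = 0 then ((2 : ℂ) ^ n) ^ 2 else 0 := by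
    rw [trace_pauli]
    split_ifs with hu
    · rw [hu, pauli_zero, one_mul, pauli_mul_star_self, Matrix.trace_one, card_qubits, sq]
    · simp
  have h5 : (pauli u * pauli v * star (pauli u * pauli v)).trace = 2 ^ n := by
    rw [hC, mul_assoc, ← mul_assoc (pauli v), pauli_mul_star_self, one_mul, pauli_mul_star_self,
      Matrix.trace_one, card_qubits]
  have h6 : (pauli u * star (pauli u * pauli v) * pauli v).trace
      = bitSign (sympForm u v) * 2 ^ n := by
    rw [pauli_mul_comm u v, star_smul, star_bitSign, star_mul, mul_smul_comm, ← mul_assoc,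
      pauli_mul_star_self, one_mul, smul_mul_assoc, star_pauli_mul_self, Matrix.trace_smul,
      Matrix.trace_one, card_qubits, smul_eq_mul]
  rw [symTrace, h1, h2, h3, h4, h5, h6]

theorem symTrace_smul (x y z : ℂ) (A B C : Matrix (Qubits n) (Qubits n) ℂ) :
    symTrace (x • A) (y • B) (z • C) = x * y * z * symTrace A B C := by
  simp only [symTrace, Matrix.trace_smul, mul_smul_comm, smul_mul_assoc, smul_eq_mul]
  ring

theorem pauliMoment_eq_symTrace (b : Qubits n) (u v : PauliLabel n) :
    2 ^ n * (2 ^ n + 1) * (2 ^ n + 2) * pauliMoment b u v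
      = symTrace (pauli u) (pauli v) (star (pauli u * pauli v)) := by
  rw [symTrace_pauli]
  by_cases hu : u = 0
  · subst hu
    by_cases hv : v = 0
    · subst hv
      simp only [pauliMoment_zero_zero, and_self, if_true, sympForm_zero_right, bitSign_zero]
      ring
    · simp only [hv, Ne.symm hv, and_false, if_true, if_false, pauliMoment_zero_left,
        sympForm_comm 0 v, sympForm_zero_right, bitSign_zero]
      linear_combination 2 ^ n * (2 ^ n + 2) * pauliMoment_zero_right b hv
  by_cases hv : v = 0
  · subst hv
    simp only [hu, false_and, if_true, if_false, sympForm_zero_right, bitSign_zero]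
    linear_combination 2 ^ n * (2 ^ n + 2) * pauliMoment_zero_right b hu
  by_cases huv : v = u
  · subst huv
    simp only [hu, false_and, if_true, if_false, sympForm_self, bitSign_zero, pauliMoment_self]
    linear_combination 2 ^ n * (2 ^ n + 2) * pauliMoment_zero_right b hu
  simp only [hu, hv, Ne.symm huv, false_and, if_false]
  rcases zmod_two_cases (sympForm u v) with h0 | h1
  · rw [h0, bitSign_zero]
    linear_combination 2 ^ n * pauliMoment_of_commute b hu hv huv (by rw [sympForm_comm, h0])
  · rw [h1, bitSign_one, pauliMoment_of_anticommute b h1]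
    ring

/-- The Clifford group is a unitary 3-design, in the form of its third moments. -/
theorem cliffordMoment_eq_symTrace (b : Qubits n) (A B C : Matrix (Qubits n) (Qubits n) ℂ) :
    2 ^ n * (2 ^ n + 1) * (2 ^ n + 2) * cliffordMoment b A B C = symTrace A B C := by
  let D : Matrix (Qubits n) (Qubits n) ℂ → Matrix (Qubits n) (Qubits n) ℂ →
      Matrix (Qubits n) (Qubits n) ℂ → ℂ := fun A B C =>
    2 ^ n * (2 ^ n + 1) * (2 ^ n + 2) * cliffordMoment b A B C - symTrace A B C
  have hlin : ∀ A B, IsLinearMap ℂ (D A B) := fun A B =>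
    { map_add := fun C C' => by
        simp only [D, (isLinearMap_cliffordMoment b A B).map_add,
          (isLinearMap_symTrace A B).map_add]
        ring
      map_smul := fun c C => by
        simp only [D, (isLinearMap_cliffordMoment b A B).map_smul,
          (isLinearMap_symTrace A B).map_smul, smul_eq_mul]
        ring }
  have hleft : ∀ A B C, D A B C = D B A C := fun A B C => by
    simp only [D, cliffordMoment_swap_left b A, symTrace_swap_left A]
  have hright : ∀ A B C, D A B C = D A C B := fun A B C => by
    simp only [D, cliffordMoment_swap_right b A B, symTrace_swap_right A B]
  have hpauli : ∀ u v w, D (pauli u) (pauli v) (pauli w) = 0 := by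
    intro u v w
    by_cases hw : u + v = w
    · obtain ⟨c, hc⟩ := star_pauli_mul u v
      have h0 : D (pauli u) (pauli v) (star (pauli u * pauli v)) = 0 :=
        sub_eq_zero.2 (pauliMoment_eq_symTrace b u v)
      rw [hc, (hlin _ _).map_smul, hw, smul_eq_zero] at h0
      refine h0.resolve_left fun hc0 => ?_
      have h1 : pauli u * pauli v * star (pauli u * pauli v) = 1 := by
        rw [star_mul, mul_assoc, ← mul_assoc (pauli v), pauli_mul_star_self, one_mul,
          pauli_mul_star_self]
      rw [hc, hc0, zero_smul, mul_zero] at h1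
      exact zero_ne_one h1
    · have h1 := eq_zero_of_pauli_invariant (F := cliffordMoment b)
        (fun h hh => cliffordMoment_map b hh) (cliffordMoment_smul b) hw
      have h2 := eq_zero_of_pauli_invariant (F := symTrace)
        (fun h _ => symTrace_map h) symTrace_smul hw
      simp only [D, h1, h2, mul_zero, sub_zero]
  have h1 : ∀ u v C, D (pauli u) (pauli v) C = 0 := fun u v C =>
    eq_zero_of_pauli (hlin _ _) (hpauli u v) C
  have h2 : ∀ u B C, D (pauli u) B C = 0 := fun u B C => by
    rw [hright]
    exact eq_zero_of_pauli (hlin _ _) (fun v => by rw [hright, h1]) B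
  have h3 : D A B C = 0 := by
    rw [hleft, hright]
    exact eq_zero_of_pauli (hlin _ _) (fun v => by rw [hright, hleft, h2]) A
  exact sub_eq_zero.1 h3

/-! ### Complete sets of mutually unbiased bases are 2-designs -/

/-- The exchange of two tensor factors. -/
noncomputable def swapMatrix (ι : Type) [DecidableEq ι] : Matrix (ι × ι) (ι × ι) ℂ :=
  Matrix.of fun x y => if x.1 = y.2 ∧ x.2 = y.1 then 1 else 0

theorem mul_swapMatrix_apply {ι : Type} [Fintype ι] [DecidableEq ι] (M : Matrix (ι × ι) (ι × ι) ℂ)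
    (x y : ι × ι) : (M * swapMatrix ι) x y = M x y.swap := by
  have h : ∀ z : ι × ι, (z.1 = y.2 ∧ z.2 = y.1) ↔ z = y.swap := fun z => by
    rw [Prod.ext_iff]; rfl
  simp only [Matrix.mul_apply, swapMatrix, Matrix.of_apply, h, mul_ite, mul_one, mul_zero,
    Finset.sum_ite_eq', Finset.mem_univ, if_true]

open scoped Kronecker in
theorem trace_kronecker_mul_swapMatrix {ι : Type} [Fintype ι] [DecidableEq ι] (A B : Matrix ι ι ℂ) :
    ((A ⊗ₖ B) * swapMatrix ι).trace = (A * B).trace := by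
  simp only [Matrix.trace, Matrix.diag, mul_swapMatrix_apply, Matrix.kroneckerMap_apply]
  simp only [Fintype.sum_prod_type, Matrix.mul_apply, Prod.fst_swap, Prod.snd_swap]

theorem swapMatrix_mul_self (ι : Type) [Fintype ι] [DecidableEq ι] :
    swapMatrix ι * swapMatrix ι = 1 := by
  ext ⟨a, b⟩ ⟨c, e⟩
  rw [mul_swapMatrix_apply]
  simp [swapMatrix, Matrix.one_apply]

theorem star_swapMatrix (ι : Type) [DecidableEq ι] :
    (swapMatrix ι).conjTranspose = swapMatrix ι := by
  ext ⟨a, b⟩ ⟨c, e⟩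
  simp only [Matrix.conjTranspose_apply, swapMatrix, Matrix.of_apply, RCLike.star_def]
  have : (c = b ∧ e = a) ↔ (a = e ∧ b = c) := by
    constructor <;> rintro ⟨rfl, rfl⟩ <;> simp
  simp only [this]
  split_ifs <;> simp

theorem trace_swapMatrix (ι : Type) [Fintype ι] [DecidableEq ι] :
    (swapMatrix ι).trace = Fintype.card ι := by
  have h := trace_kronecker_mul_swapMatrix (1 : Matrix ι ι ℂ) 1
  rw [Matrix.one_kronecker_one, one_mul, one_mul, Matrix.trace_one] at h
  exact h

open scoped Kronecker in
/-- A family of projections that meets the Welch bound is a 2-design: the operator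
`∑ P_i ⊗ P_i - 1 - SWAP` has Hilbert-Schmidt norm zero. -/
theorem sum_trace_mul_trace_of_welch {ι T : Type} [Fintype ι] [DecidableEq ι] [Fintype T]
    {P : T → Matrix ι ι ℂ} (hP : ∀ i, (P i).IsHermitian) (htr : ∀ i, (P i).trace = 1)
    (hidem : ∀ i, P i * P i = P i)
    (hcard : (Fintype.card T : ℂ) = Fintype.card ι * (Fintype.card ι + 1))
    (hwelch : ∀ i, ∑ j, (P i * P j).trace ^ 2 = 2) (A B : Matrix ι ι ℂ) :
    ∑ i, (A * P i).trace * (B * P i).trace = A.trace * B.trace + (A * B).trace := by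
  set W := ∑ i, P i ⊗ₖ P i with hW
  set D := W - 1 - swapMatrix ι with hD
  have hWS : (W * swapMatrix ι).trace = Fintype.card T := by
    rw [hW, Finset.sum_mul, Matrix.trace_sum]
    simp only [trace_kronecker_mul_swapMatrix, hidem, htr]
    simp
  have hWtr : W.trace = Fintype.card T := by
    rw [hW, Matrix.trace_sum]
    simp only [Matrix.trace_kronecker, htr]
    simp
  have hWW : (W * W).trace = 2 * Fintype.card T := by
    rw [hW, Finset.sum_mul, Matrix.trace_sum]
    simp only [Finset.mul_sum, Matrix.trace_sum, ← Matrix.mul_kronecker_mul, Matrix.trace_kronecker,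
      ← sq, hwelch]
    simp [mul_comm]
  have hDD : (D * D).trace = 0 := by
    have : D * D = W * W + 1 + 1 - W - W - W * swapMatrix ι - swapMatrix ι * W
        + swapMatrix ι + swapMatrix ι := by
      rw [hD]
      simp only [sub_mul, mul_sub, one_mul, mul_one, swapMatrix_mul_self]
      abel
    rw [this]
    simp only [Matrix.trace_add, Matrix.trace_sub, Matrix.trace_mul_comm (swapMatrix ι), hWW, hWtr,
      hWS, Matrix.trace_one, trace_swapMatrix, Fintype.card_prod, hcard]
    push_cast
    ring
  have hWstar : W.conjTranspose = W := by
    rw [hW, Matrix.conjTranspose_sum]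
    refine Finset.sum_congr rfl fun i _ => ?_
    rw [Matrix.conjTranspose_kronecker, (hP i).eq]
  have hDstar : D.conjTranspose = D := by
    rw [hD, Matrix.conjTranspose_sub, Matrix.conjTranspose_sub, hWstar, star_swapMatrix,
      Matrix.conjTranspose_one]
  have hD0 : D = 0 := by
    rw [← Matrix.trace_conjTranspose_mul_self_eq_zero_iff, hDstar, hDD]
  have h := congrArg (fun M => ((A ⊗ₖ B) * M).trace) hD0
  simp only [hD, hW, mul_sub, mul_one, Matrix.trace_sub, trace_kronecker_mul_swapMatrix,
    Finset.mul_sum, Matrix.trace_sum, ← Matrix.mul_kronecker_mul, Matrix.trace_kronecker, mul_zero,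
    Matrix.trace_zero] at h
  linear_combination h

theorem ketBra_ket {ι : Type} [DecidableEq ι] (b : ι) : ketBra (ket b) = Matrix.single b b 1 := by
  ext x y
  simp only [ketBra, ket, Matrix.vecMulVec_apply, Pi.star_apply, Matrix.single_apply,
    Pi.single_apply]
  by_cases hx : b = x <;> by_cases hy : b = y <;> simp [hx, hy, Ne.symm, eq_comm]

theorem star_ketBra {ι : Type} (v : ι → ℂ) : (ketBra v).conjTranspose = ketBra v := by
  simp [ketBra, Matrix.conjTranspose_vecMulVec]

theorem trace_ketBra_mul_ketBra {ι : Type} [Fintype ι] (v w : ι → ℂ) :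
    (ketBra v * ketBra w).trace = ((‖star v ⬝ᵥ w‖ ^ 2 : ℝ) : ℂ) := by
  rw [ketBra, ketBra, Matrix.vecMulVec_mul_vecMulVec, Matrix.vecMulVec_smul, Matrix.trace_smul,
    Matrix.trace_vecMulVec, smul_eq_mul, ← Complex.normSq_eq_norm_sq, ← Complex.mul_conj]
  congr 1
  rw [starRingEnd_apply, Matrix.star_dotProduct, star_star, dotProduct_comm]

/-- The projection onto the `k`-th vector of the basis `{U† |k⟩}`. -/
noncomputable def basisProj {n : ℕ} (U : unitary (Matrix (Qubits n) (Qubits n) ℂ)) (k : Qubits n) :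
    Matrix (Qubits n) (Qubits n) ℂ :=
  ketBra ((star (U : Matrix (Qubits n) (Qubits n) ℂ)).mulVec (ket k))

theorem symm_conjStarAlgAut_ketBra (U : unitary (Matrix (Qubits n) (Qubits n) ℂ)) (k : Qubits n) :
    (Unitary.conjStarAlgAut ℂ _ U).symm (ketBra (ket k)) = basisProj U k := by
  rw [Unitary.conjStarAlgAut_symm, Unitary.conjStarAlgAut_apply, basisProj, ketBra, ketBra,
    Matrix.star_mulVec, Unitary.coe_star, star_star, Matrix.mul_vecMulVec, Matrix.vecMulVec_mul,
    Matrix.star_eq_conjTranspose, Matrix.conjTranspose_conjTranspose]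

theorem basisProj_mul (U : unitary (Matrix (Qubits n) (Qubits n) ℂ)) (k l : Qubits n) :
    basisProj U k * basisProj U l = if k = l then basisProj U k else 0 := by
  simp only [← symm_conjStarAlgAut_ketBra, ← map_mul, ketBra_ket]
  split_ifs with h
  · subst h
    simp
  · simp [h]

theorem trace_basisProj (U : unitary (Matrix (Qubits n) (Qubits n) ℂ)) (k : Qubits n) :
    (basisProj U k).trace = 1 := by
  rw [← symm_conjStarAlgAut_ketBra, ketBra_ket]
  refine (Matrix.trace_map (Unitary.conjStarAlgAut ℂ _ U).symm.toAlgEquiv _).trans ?_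
  simp

theorem sum_basisProj (U : unitary (Matrix (Qubits n) (Qubits n) ℂ)) :
    ∑ k, basisProj U k = 1 := by
  simp only [← symm_conjStarAlgAut_ketBra, ← map_sum, ketBra_ket, Matrix.sum_single_one, map_one]

theorem IsCompleteMUB.trace_mul {U : Fin (2 ^ n + 1) → unitary (Matrix (Qubits n) (Qubits n) ℂ)}
    (hU : IsCompleteMUB n U) {i j : Fin (2 ^ n + 1)} (hij : i ≠ j) (k l : Qubits n) :
    (basisProj (U i) k * basisProj (U j) l).trace = 1 / 2 ^ n := by
  rw [basisProj, basisProj, trace_ketBra_mul_ketBra, hU.2 i j hij]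
  simp

/-- A complete set of mutually unbiased bases is a 2-design. -/
theorem IsCompleteMUB.sum_trace_mul_trace
    {U : Fin (2 ^ n + 1) → unitary (Matrix (Qubits n) (Qubits n) ℂ)} (hU : IsCompleteMUB n U)
    (A B : Matrix (Qubits n) (Qubits n) ℂ) :
    ∑ i, ∑ k, (A * basisProj (U i) k).trace * (B * basisProj (U i) k).trace
      = A.trace * B.trace + (A * B).trace := by
  rw [← sum_trace_mul_trace_of_welch
    (P := fun t : Fin (2 ^ n + 1) × Qubits n => basisProj (U t.1) t.2)
    (fun t => star_ketBra _) (fun t => trace_basisProj _ _)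
    (fun t => by rw [basisProj_mul, if_pos rfl])
    ?_ ?_ A B, Fintype.sum_prod_type]
  · rw [Fintype.card_prod, Fintype.card_fin, Nat.cast_mul, card_qubits]
    push_cast
    ring
  · rintro ⟨i, k⟩
    have hsame : ∑ l, (basisProj (U i) k * basisProj (U i) l).trace ^ 2 = 1 := by
      rw [Finset.sum_eq_single k]
      · rw [basisProj_mul, if_pos rfl, trace_basisProj, one_pow]
      · intro l _ hl
        rw [basisProj_mul, if_neg (Ne.symm hl)]
        simp
      · simp
    have hdiff : ∀ j ∈ Finset.univ.erase i,
        ∑ l, (basisProj (U i) k * basisProj (U j) l).trace ^ 2 = 1 / 2 ^ n := by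
      intro j hj
      have hij := (Finset.ne_of_mem_erase hj).symm
      simp only [hU.trace_mul hij]
      rw [Finset.sum_const, Finset.card_univ, nsmul_eq_mul, card_qubits]
      field_simp
    rw [Fintype.sum_prod_type, ← Finset.add_sum_erase _ _ (Finset.mem_univ i)]
    simp only
    rw [hsame, Finset.sum_congr rfl hdiff, Finset.sum_const, Finset.card_erase_of_mem
      (Finset.mem_univ i), Finset.card_univ, Fintype.card_fin, Nat.add_sub_cancel, nsmul_eq_mul]
    push_cast
    rw [mul_one_div_cancel (by positivity)]
    norm_num

/-! ### The observables -/

/-- The vector `(|j⟩ + c |k⟩) / √2`, which is `|φ_jk⟩` for `c = 1` and `|ψ_jk⟩` for `c = i`. -/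
noncomputable def pairKet {ι : Type} [DecidableEq ι] (c : ℂ) (j k : ι) : ι → ℂ :=
  ((Real.sqrt 2 : ℝ) : ℂ)⁻¹ • (ket j + c • ket k)

theorem phiKet_eq_pairKet {ι : Type} [DecidableEq ι] (j k : ι) : phiKet j k = pairKet 1 j k := by
  rw [phiKet, pairKet, one_smul]

theorem psiKet_eq_pairKet {ι : Type} [DecidableEq ι] (j k : ι) :
    psiKet j k = pairKet Complex.I j k := rfl

theorem inv_sqrt_two_mul_self : ((Real.sqrt 2 : ℝ) : ℂ)⁻¹ * ((Real.sqrt 2 : ℝ) : ℂ)⁻¹ = 1 / 2 := by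
  rw [← mul_inv, ← Complex.ofReal_mul, Real.mul_self_sqrt (by norm_num)]
  norm_num

theorem star_inv_sqrt_two : star ((Real.sqrt 2 : ℝ) : ℂ)⁻¹ = ((Real.sqrt 2 : ℝ) : ℂ)⁻¹ := by
  rw [star_inv₀]
  simp

theorem trace_mul_ketBra_pairKet {ι : Type} [Fintype ι] [DecidableEq ι] (A : Matrix ι ι ℂ) (c : ℂ)
    (j k : ι) : (A * ketBra (pairKet c j k)).trace
      = (A j j + c * A j k + star c * A k j + c * star c * A k k) / 2 := by
  rw [ketBra, Matrix.mul_vecMulVec, Matrix.trace_vecMulVec]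
  simp only [pairKet, ket, star_smul, star_add, Pi.star_single, star_one, star_inv_sqrt_two,
    Matrix.mulVec_smul, Matrix.mulVec_add, Matrix.mulVec_single_one, dotProduct_smul,
    dotProduct_add, dotProduct_single, Matrix.col_apply, mul_one,
    Pi.smul_apply, Pi.add_apply, smul_eq_mul]
  linear_combination (A j j + c * A j k + star c * A k j + c * star c * A k k) *
    inv_sqrt_two_mul_self

theorem trace_ketBra_pairKet {ι : Type} [Fintype ι] [DecidableEq ι] {c : ℂ} (hc : c * star c = 1)
    {j k : ι} (hjk : j ≠ k) : (ketBra (pairKet c j k)).trace = 1 := by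
  have h := trace_mul_ketBra_pairKet 1 c j k
  rw [one_mul] at h
  rw [h, hc]
  simp [hjk, hjk.symm]

theorem ketBra_pairKet_mul_self {ι : Type} [Fintype ι] [DecidableEq ι] {c : ℂ}
    (hc : c * star c = 1) {j k : ι} (hjk : j ≠ k) :
    ketBra (pairKet c j k) * ketBra (pairKet c j k) = ketBra (pairKet c j k) := by
  have h := trace_ketBra_pairKet hc hjk
  rw [ketBra, Matrix.trace_vecMulVec] at h
  rw [ketBra, Matrix.vecMulVec_mul_vecMulVec, dotProduct_comm, h, one_smul]

/-- A vector whose entries have modulus `√r` overlaps little with a superposition of two basis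
vectors. -/
theorem trace_ketBra_mul_ketBra_pairKet_re_le {ι : Type} [Fintype ι] [DecidableEq ι] {c : ℂ}
    (hc : ‖c‖ = 1) (j k : ι) (w : ι → ℂ) {r : ℝ} (hj : ‖w j‖ ^ 2 = r) (hk : ‖w k‖ ^ 2 = r) :
    (ketBra w * ketBra (pairKet c j k)).trace.re ≤ 2 * r := by
  have hdot : star w ⬝ᵥ pairKet c j k
      = ((Real.sqrt 2 : ℝ) : ℂ)⁻¹ * (star (w j) + c * star (w k)) := by
    simp only [pairKet, ket, dotProduct_smul, dotProduct_add, dotProduct_single, smul_eq_mul,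
      mul_one, Pi.star_apply]
  have hn : ‖star (w j) + c * star (w k)‖ ≤ ‖w j‖ + ‖w k‖ := by
    refine (norm_add_le _ _).trans_eq ?_
    rw [norm_mul, hc, one_mul, norm_star, norm_star]
  rw [trace_ketBra_mul_ketBra, Complex.ofReal_re, hdot, norm_mul, mul_pow, norm_inv,
    Complex.norm_real, Real.norm_eq_abs, abs_of_nonneg (Real.sqrt_nonneg _), inv_pow,
    Real.sq_sqrt (by norm_num)]
  have h2 : ‖star (w j) + c * star (w k)‖ ^ 2 ≤ (‖w j‖ + ‖w k‖) ^ 2 := by gcongr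
  nlinarith [sq_nonneg (‖w j‖ - ‖w k‖)]

/-! ### Expectations of projections -/

/-- `tr(A O) = tr(O A O)`. -/
theorem trace_mul_nonneg_of_projection {ι : Type} [Fintype ι] [DecidableEq ι] {A O : Matrix ι ι ℂ}
    (hA : A.PosSemidef) (hO : O.conjTranspose = O) (hO2 : O * O = O) : 0 ≤ (A * O).trace := by
  have h := (hA.mul_mul_conjTranspose_same O).trace_nonneg
  rwa [hO, Matrix.trace_mul_comm, ← mul_assoc, hO2, Matrix.trace_mul_comm] at h

theorem trace_mul_le_of_projection {ι : Type} [Fintype ι] [DecidableEq ι] {A O : Matrix ι ι ℂ}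
    (hA : A.PosSemidef) (hO : O.conjTranspose = O) (hO2 : O * O = O) :
    (A * O).trace ≤ A.trace := by
  have h := trace_mul_nonneg_of_projection (O := 1 - O) hA
    (by rw [Matrix.conjTranspose_sub, Matrix.conjTranspose_one, hO])
    (by rw [sub_mul, one_mul, mul_sub, mul_one, hO2]; simp)
  rw [mul_sub, mul_one, Matrix.trace_sub] at h
  exact sub_nonneg.1 h

theorem eq_ofReal_re_of_nonneg {z : ℂ} (hz : 0 ≤ z) : z = (z.re : ℂ) := by
  apply Complex.ext
  · rfl
  · exact (Complex.nonneg_iff.1 hz).2.symm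

theorem DensityMatrix.re_trace_mul_mem {ι : Type} [Fintype ι] [DecidableEq ι] (ρ : DensityMatrix ι)
    {O : Matrix ι ι ℂ} (hO : O.conjTranspose = O) (hO2 : O * O = O) :
    (ρ.mat * O).trace = ((ρ.mat * O).trace.re : ℂ) ∧ 0 ≤ (ρ.mat * O).trace.re ∧
      (ρ.mat * O).trace.re ≤ 1 := by
  have h0 := trace_mul_nonneg_of_projection ρ.posSemidef hO hO2
  have h1 := trace_mul_le_of_projection ρ.posSemidef hO hO2
  rw [ρ.trace_eq_one] at h1
  exact ⟨eq_ofReal_re_of_nonneg h0, (Complex.le_def.1 h0).1, (Complex.le_def.1 h1).1⟩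

theorem DensityMatrix.measure_apply_toReal {ι : Type} [Fintype ι] (ρ : DensityMatrix ι) (j : ι) :
    (ρ.measure j).toReal = (ρ.mat j j).re :=
  ENNReal.toReal_ofReal (Complex.nonneg_iff.1 (ρ.posSemidef.diag_nonneg (i := j))).1

theorem DensityMatrix.diag_eq_ofReal {ι : Type} [Fintype ι] (ρ : DensityMatrix ι) (j : ι) :
    ρ.mat j j = ((ρ.mat j j).re : ℂ) :=
  eq_ofReal_re_of_nonneg (ρ.posSemidef.diag_nonneg (i := j))

theorem sum_toReal_eq_one {α : Type} [Fintype α] (p : PMF α) : ∑ a, (p a).toReal = 1 := by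
  rw [← ENNReal.toReal_sum fun a _ => p.apply_ne_top a, ← tsum_fintype (L := .unconditional α),
    p.tsum_coe, ENNReal.toReal_one]

/-! ### Moments of classical shadows -/

theorem ShadowProtocol.shot_apply_toReal {ι : Type} [Fintype ι] [DecidableEq ι]
    (S : ShadowProtocol ι) (ρ : DensityMatrix ι) (s : S.Setting) (b : ι) :
    (S.shot ρ (s, b)).toReal = (S.law s).toReal * (S.evol s ρ.mat b b).re := by
  classical
  have h : S.shot ρ (s, b) = S.law s * (ρ.evolve (S.evol s)).measure b := by
    rw [ShadowProtocol.shot, PMF.bind_apply, tsum_eq_single s]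
    · rw [PMF.map_apply, tsum_eq_single b]
      · simp
      · intro b' hb'
        rw [if_neg]
        simpa using Ne.symm hb'
    · intro s' hs'
      rw [PMF.map_apply]
      simp [Ne.symm hs']
  rw [h, ENNReal.toReal_mul, DensityMatrix.measure_apply_toReal]
  rfl

theorem ShadowProtocol.evol_diag_nonneg {ι : Type} [Fintype ι] [DecidableEq ι]
    (S : ShadowProtocol ι) (ρ : DensityMatrix ι) (s : S.Setting) (b : ι) :
    0 ≤ S.evol s ρ.mat b b :=
  (ρ.evolve (S.evol s)).posSemidef.diag_nonneg (i := b)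

/-- The mean of the real part of a statistic, as a complex double sum over settings and outcomes. -/
theorem ShadowProtocol.sum_shot_mul_re {ι : Type} [Fintype ι] [DecidableEq ι]
    (S : ShadowProtocol ι) (ρ : DensityMatrix ι) (t : S.Setting × ι → ℂ) :
    ∑ r, (S.shot ρ r).toReal * (t r).re
      = (∑ s, ∑ b, ((S.law s).toReal : ℂ) * (S.evol s ρ.mat b b) * t (s, b)).re := by
  rw [Fintype.sum_prod_type, Complex.re_sum]
  refine Finset.sum_congr rfl fun s _ => ?_
  rw [Complex.re_sum]
  refine Finset.sum_congr rfl fun b _ => ?_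
  rw [S.shot_apply_toReal, eq_ofReal_re_of_nonneg (S.evol_diag_nonneg ρ s b), Complex.ofReal_re,
    ← Complex.ofReal_mul, Complex.re_ofReal_mul]

theorem trace_snapshot_cliffordProtocol (r : (cliffordProtocol n).Setting × Qubits n)
    {O : Matrix (Qubits n) (Qubits n) ℂ} (hO : O.trace = 1) :
    ((cliffordProtocol n).snapshot r * O).trace
      = (2 ^ n + 1) * (cliffordProtocol n).evol r.1 O r.2 r.2 - 1 := by
  have htr : (((cliffordProtocol n).evol r.1).symm (Matrix.single r.2 r.2 (1 : ℂ))).trace = 1 := by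
    refine (Matrix.trace_map ((cliffordProtocol n).evol r.1).symm.toAlgEquiv _).trans ?_
    simp
  have h : (cliffordProtocol n).snapshot r
      = ((2 : ℂ) ^ n + 1) • ((cliffordProtocol n).evol r.1).symm (Matrix.single r.2 r.2 1) - 1 := by
    rw [ShadowProtocol.snapshot, ketBra_ket]
    change ((2 : ℂ) ^ n + 1) • _ - Matrix.trace _ • 1 = _
    rw [htr, one_smul]
  rw [h, sub_mul, one_mul, Matrix.trace_sub, hO, smul_mul_assoc, Matrix.trace_smul, smul_eq_mul,
    Matrix.trace_mul_comm, ← apply_diag_eq_trace]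

theorem cliffordProtocol_law_toReal (g : cliffordGroup n) :
    (((cliffordProtocol n).law g).toReal : ℂ) = (Fintype.card (cliffordGroup n) : ℂ)⁻¹ := by
  change (((PMF.uniformOfFintype (cliffordGroup n)) g).toReal : ℂ) = _
  rw [PMF.uniformOfFintype_apply]
  simp

theorem sum_clifford_eq_sum_moment (A B C : Matrix (Qubits n) (Qubits n) ℂ) :
    ∑ g, ∑ b, (((cliffordProtocol n).law g).toReal : ℂ) * (cliffordProtocol n).evol g A b b *
      ((cliffordProtocol n).evol g B b b * (cliffordProtocol n).evol g C b b)
      = ∑ b, cliffordMoment b A B C := by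
  rw [Finset.sum_comm]
  refine Finset.sum_congr rfl fun b _ => ?_
  rw [cliffordMoment, Finset.mul_sum]
  have h : ∀ g : cliffordGroup n, (((cliffordProtocol n).law g).toReal : ℂ) * g.1 A b b *
      (g.1 B b b * g.1 C b b) = (Fintype.card (cliffordGroup n) : ℂ)⁻¹ *
        (g.1 A b b * g.1 B b b * g.1 C b b) := fun g => by
    rw [cliffordProtocol_law_toReal]
    ring
  exact Finset.sum_congr rfl fun g _ => h g

theorem sum_cliffordMoment (A B C : Matrix (Qubits n) (Qubits n) ℂ) :
    (2 ^ n + 1) * (2 ^ n + 2) * ∑ b, cliffordMoment b A B C = symTrace A B C := by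
  have hd : (2 : ℂ) ^ n ≠ 0 := by positivity
  apply mul_left_cancel₀ hd
  calc (2 : ℂ) ^ n * ((2 ^ n + 1) * (2 ^ n + 2) * ∑ b, cliffordMoment b A B C)
      = ∑ b, 2 ^ n * (2 ^ n + 1) * (2 ^ n + 2) * cliffordMoment b A B C := by
        rw [Finset.mul_sum, Finset.mul_sum]
        exact Finset.sum_congr rfl fun b _ => by ring
    _ = 2 ^ n * symTrace A B C := by
        simp only [cliffordMoment_eq_symTrace]
        rw [Finset.sum_const, Finset.card_univ, nsmul_eq_mul, card_qubits]

theorem cliffordProtocol_mean (ρ : DensityMatrix (Qubits n)) {O : Matrix (Qubits n) (Qubits n) ℂ}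
    (hO : O.trace = 1) :
    ∑ r, ((cliffordProtocol n).shot ρ r).toReal * ((cliffordProtocol n).snapshot r * O).trace.re
      = (ρ.mat * O).trace.re := by
  rw [ShadowProtocol.sum_shot_mul_re _ _ fun r => ((cliffordProtocol n).snapshot r * O).trace]
  congr 1
  have h1 := sum_clifford_eq_sum_moment ρ.mat O 1
  have h2 := sum_clifford_eq_sum_moment ρ.mat 1 1
  have h3 := sum_cliffordMoment ρ.mat O 1
  have h4 := sum_cliffordMoment ρ.mat 1 1
  simp only [map_one, Matrix.one_apply_eq, mul_one] at h1 h2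
  simp only [symTrace, mul_one, hO, ρ.trace_eq_one, Matrix.trace_one, card_qubits, one_mul] at h3 h4
  simp only [trace_snapshot_cliffordProtocol _ hO, mul_sub, mul_one, Finset.sum_sub_distrib]
  have h5 : ∑ g, ∑ b, (((cliffordProtocol n).law g).toReal : ℂ) *
      (cliffordProtocol n).evol g ρ.mat b b * ((2 ^ n + 1) * (cliffordProtocol n).evol g O b b)
      = (2 ^ n + 1) * ∑ b, cliffordMoment b ρ.mat O 1 := by
    rw [← h1, Finset.mul_sum]
    refine Finset.sum_congr rfl fun g _ => ?_
    rw [Finset.mul_sum]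
    exact Finset.sum_congr rfl fun b _ => by ring
  rw [h5, h2]
  have hd1 : (2 : ℂ) ^ n + 1 ≠ 0 := by positivity
  have hd2 : (2 : ℂ) ^ n + 2 ≠ 0 := by positivity
  apply mul_left_cancel₀ (mul_ne_zero hd1 hd2)
  linear_combination (2 ^ n + 1) * h3 - h4

/-- The 3-design property gives `E x ^ 2 = (2 + 4 tr(ρ O)) / ((d + 1) (d + 2))` for the outcome
weight `x` of `O`, and the estimate is `(d + 1) x - 1`. -/
theorem cliffordProtocol_second_moment (ρ : DensityMatrix (Qubits n))
    {O : Matrix (Qubits n) (Qubits n) ℂ} (hO : O.trace = 1) (hOs : O.conjTranspose = O)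
    (hO2 : O * O = O) :
    ∑ r, ((cliffordProtocol n).shot ρ r).toReal *
      ((cliffordProtocol n).snapshot r * O).trace.re ^ 2 ≤ 16 := by
  have hpsd : O.PosSemidef := by
    have := Matrix.posSemidef_conjTranspose_mul_self O
    rwa [hOs, hO2] at this
  let σ : DensityMatrix (Qubits n) := ⟨O, hpsd, hO⟩
  let x : (cliffordProtocol n).Setting × Qubits n → ℝ := fun r =>
    ((cliffordProtocol n).evol r.1 O r.2 r.2).re
  have hx : ∀ r : (cliffordProtocol n).Setting × Qubits n,
      (cliffordProtocol n).evol r.1 O r.2 r.2 = (x r : ℂ) := fun r =>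
    eq_ofReal_re_of_nonneg ((cliffordProtocol n).evol_diag_nonneg σ r.1 r.2)
  have hx0 : ∀ r, 0 ≤ x r := fun r =>
    (Complex.nonneg_iff.1 ((cliffordProtocol n).evol_diag_nonneg σ r.1 r.2)).1
  have ht : ∀ r, ((cliffordProtocol n).snapshot r * O).trace.re = (2 ^ n + 1) * x r - 1 := by
    intro r
    have : ((cliffordProtocol n).snapshot r * O).trace = (((2 ^ n + 1) * x r - 1 : ℝ) : ℂ) := by
      rw [trace_snapshot_cliffordProtocol r hO, hx]
      push_cast
      ring
    rw [this, Complex.ofReal_re]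
  have hbound : ∀ r, ((cliffordProtocol n).shot ρ r).toReal *
      ((cliffordProtocol n).snapshot r * O).trace.re ^ 2
      ≤ (2 ^ n + 1) ^ 2 * (((cliffordProtocol n).shot ρ r).toReal * x r ^ 2)
        + ((cliffordProtocol n).shot ρ r).toReal := by
    intro r
    rw [ht]
    have hp : 0 ≤ ((cliffordProtocol n).shot ρ r).toReal := ENNReal.toReal_nonneg
    have : 0 ≤ (2 * (2 ^ n + 1)) * (((cliffordProtocol n).shot ρ r).toReal * x r) :=
      mul_nonneg (by positivity) (mul_nonneg hp (hx0 r))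
    nlinarith
  have hsq : ∑ r, ((cliffordProtocol n).shot ρ r).toReal * x r ^ 2
      = (∑ b, cliffordMoment b ρ.mat O O).re := by
    rw [← sum_clifford_eq_sum_moment]
    have := ShadowProtocol.sum_shot_mul_re (cliffordProtocol n) ρ
      (fun r => (cliffordProtocol n).evol r.1 O r.2 r.2 * (cliffordProtocol n).evol r.1 O r.2 r.2)
    rw [← this]
    refine Finset.sum_congr rfl fun r _ => ?_
    rw [hx, ← Complex.ofReal_mul, Complex.ofReal_re, sq]
  obtain ⟨hm, hm0, hm1⟩ := ρ.re_trace_mul_mem hOs hO2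
  have hmom : (2 ^ n + 1) * (2 ^ n + 2) * (∑ b, cliffordMoment b ρ.mat O O).re
      = 2 + 4 * (ρ.mat * O).trace.re := by
    have h := congrArg Complex.re (sum_cliffordMoment ρ.mat O O)
    have hc : ((2 : ℂ) ^ n + 1) * (2 ^ n + 2) = (((2 ^ n + 1) * (2 ^ n + 2) : ℝ) : ℂ) := by
      push_cast; ring
    rw [hc, Complex.re_ofReal_mul] at h
    rw [h, symTrace, hO2, mul_assoc ρ.mat, hO2, hO, ρ.trace_eq_one]
    simp only [mul_one, Complex.add_re, Complex.one_re]
    ring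
  have hmom0 : 0 ≤ (∑ b, cliffordMoment b ρ.mat O O).re := by
    rw [← hsq]
    exact Finset.sum_nonneg fun r _ => mul_nonneg ENNReal.toReal_nonneg (sq_nonneg _)
  calc _ ≤ ∑ r, ((2 ^ n + 1) ^ 2 * (((cliffordProtocol n).shot ρ r).toReal * x r ^ 2)
        + ((cliffordProtocol n).shot ρ r).toReal) := Finset.sum_le_sum fun r _ => hbound r
    _ = (2 ^ n + 1) ^ 2 * (∑ b, cliffordMoment b ρ.mat O O).re + 1 := by
        rw [Finset.sum_add_distrib, ← Finset.mul_sum, hsq, sum_toReal_eq_one]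
    _ ≤ (2 ^ n + 1) * (2 ^ n + 2) * (∑ b, cliffordMoment b ρ.mat O O).re + 1 := by
        rw [sq]
        gcongr
        norm_num
    _ ≤ 16 := by rw [hmom]; linarith

theorem trace_snapshot_mubProtocol_zero
    {U : Fin (2 ^ n + 1) → unitary (Matrix (Qubits n) (Qubits n) ℂ)} (hU : IsCompleteMUB n U)
    (b : Qubits n) {O : Matrix (Qubits n) (Qubits n) ℂ} (hO : O.trace = 1) :
    ((mubProtocol n U).snapshot ((0 : Fin (2 ^ n + 1)), b) * O).trace
      = 2 * (O * basisProj (U 0) b).trace - 1 / 2 ^ n := by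
  have hb : ∀ k, ketBra (ket k) = basisProj (U 0) k := fun k => by
    rw [basisProj, hU.1]; simp
  have hd : (2 : ℂ) ^ n ≠ 0 := by positivity
  have hX : ((mubProtocol n U).evol (0 : Fin (2 ^ n + 1))).symm (ketBra (ket b))
      = basisProj (U 0) b := symm_conjStarAlgAut_ketBra (U 0) b
  have hsum : ∑ k : Qubits n, (basisProj (U 0) b * ketBra (ket k)).trace • ketBra (ket k)
      = basisProj (U 0) b := by
    rw [Finset.sum_eq_single b]
    · rw [hb, basisProj_mul, if_pos rfl, trace_basisProj, one_smul]
    · intro k _ hk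
      rw [hb, basisProj_mul, if_neg (Ne.symm hk), Matrix.trace_zero, zero_smul]
    · simp
  rw [ShadowProtocol.snapshot, hX]
  change (((2 : ℂ) ^ (n + 1) • (basisProj (U 0) b - (((2 : ℂ) ^ n - 1) / 2 ^ n) •
        ∑ k : Qubits n, (basisProj (U 0) b * ketBra (ket k)).trace • ketBra (ket k))
      - ((basisProj (U 0) b).trace / 2 ^ n) • 1) * O).trace = _
  rw [hsum, trace_basisProj, sub_mul, smul_mul_assoc, sub_mul, smul_mul_assoc, smul_mul_assoc,
    one_mul, Matrix.trace_sub, Matrix.trace_smul, Matrix.trace_sub, Matrix.trace_smul,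
    Matrix.trace_smul, hO, Matrix.trace_mul_comm O]
  simp only [smul_eq_mul, pow_succ]
  field_simp
  ring

theorem trace_snapshot_mubProtocol_of_ne_zero
    {U : Fin (2 ^ n + 1) → unitary (Matrix (Qubits n) (Qubits n) ℂ)} (hU : IsCompleteMUB n U)
    {i : Fin (2 ^ n + 1)} (hi : i ≠ 0) (b : Qubits n) {O : Matrix (Qubits n) (Qubits n) ℂ}
    (hO : O.trace = 1) :
    ((mubProtocol n U).snapshot (i, b) * O).trace
      = 2 * 2 ^ n * (O * basisProj (U i) b).trace - (2 * 2 ^ n - 1) / 2 ^ n := by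
  have hb : ∀ k, ketBra (ket k) = basisProj (U 0) k := fun k => by
    rw [basisProj, hU.1]; simp
  have hd : (2 : ℂ) ^ n ≠ 0 := by positivity
  have hX : ((mubProtocol n U).evol i).symm (ketBra (ket b))
      = basisProj (U i) b := symm_conjStarAlgAut_ketBra (U i) b
  have hsum : ∑ k : Qubits n, (basisProj (U i) b * ketBra (ket k)).trace • ketBra (ket k)
      = (1 / 2 ^ n : ℂ) • 1 := by
    simp only [hb, hU.trace_mul hi]
    rw [← Finset.smul_sum, sum_basisProj]
  rw [ShadowProtocol.snapshot, hX]
  change (((2 : ℂ) ^ (n + 1) • (basisProj (U i) b - (((2 : ℂ) ^ n - 1) / 2 ^ n) •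
        ∑ k : Qubits n, (basisProj (U i) b * ketBra (ket k)).trace • ketBra (ket k))
      - ((basisProj (U i) b).trace / 2 ^ n) • 1) * O).trace = _
  rw [hsum, trace_basisProj, sub_mul, smul_mul_assoc, sub_mul, smul_mul_assoc, smul_mul_assoc,
    one_mul, Matrix.trace_sub, Matrix.trace_smul, Matrix.trace_sub,
    Matrix.trace_smul, Matrix.trace_smul, hO, Matrix.trace_mul_comm O]
  simp only [smul_eq_mul, pow_succ]
  field_simp
  ring

theorem mubProtocol_evol_diag (U : Fin (2 ^ n + 1) → unitary (Matrix (Qubits n) (Qubits n) ℂ))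
    (i : Fin (2 ^ n + 1)) (A : Matrix (Qubits n) (Qubits n) ℂ) (b : Qubits n) :
    (mubProtocol n U).evol i A b b = (A * basisProj (U i) b).trace := by
  rw [apply_diag_eq_trace, ← ketBra_ket]
  exact congrArg (fun X => (A * X).trace) (symm_conjStarAlgAut_ketBra (U i) b)

theorem mubProtocol_law_zero (U : Fin (2 ^ n + 1) → unitary (Matrix (Qubits n) (Qubits n) ℂ)) :
    (((mubProtocol n U).law (0 : Fin (2 ^ n + 1))).toReal : ℂ) = 1 / 2 := by
  change ((biasedLaw n 0).toReal : ℂ) = _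
  simp [biasedLaw, PMF.ofFintype_apply]

theorem mubProtocol_law_succ (U : Fin (2 ^ n + 1) → unitary (Matrix (Qubits n) (Qubits n) ℂ))
    (i : Fin (2 ^ n)) :
    (((mubProtocol n U).law (i.succ : Fin (2 ^ n + 1))).toReal : ℂ) = 1 / (2 * 2 ^ n) := by
  change ((biasedLaw n i.succ).toReal : ℂ) = _
  simp [biasedLaw, PMF.ofFintype_apply, pow_succ, mul_comm]

theorem mubProtocol_mean
    {U : Fin (2 ^ n + 1) → unitary (Matrix (Qubits n) (Qubits n) ℂ)} (hU : IsCompleteMUB n U)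
    (ρ : DensityMatrix (Qubits n)) {O : Matrix (Qubits n) (Qubits n) ℂ} (hO : O.trace = 1) :
    ∑ r, ((mubProtocol n U).shot ρ r).toReal * ((mubProtocol n U).snapshot r * O).trace.re
      = (ρ.mat * O).trace.re := by
  rw [ShadowProtocol.sum_shot_mul_re _ _ fun r => ((mubProtocol n U).snapshot r * O).trace]
  congr 1
  have hd : (2 : ℂ) ^ n ≠ 0 := by positivity
  have hρ : ∀ i, ∑ b, (ρ.mat * basisProj (U i) b).trace = 1 := by
    intro i
    rw [← Matrix.trace_sum, ← Finset.mul_sum, sum_basisProj, mul_one, ρ.trace_eq_one]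
  have h0 : ∑ b, (((mubProtocol n U).law (0 : Fin (2 ^ n + 1))).toReal : ℂ) *
      (mubProtocol n U).evol (0 : Fin (2 ^ n + 1)) ρ.mat b b *
      ((mubProtocol n U).snapshot ((0 : Fin (2 ^ n + 1)), b) * O).trace
      = ∑ b, (ρ.mat * basisProj (U 0) b).trace * (O * basisProj (U 0) b).trace
        - 1 / (2 * 2 ^ n) := by
    have hconst : (1 : ℂ) / (2 * 2 ^ n)
        = ∑ b, 1 / (2 * 2 ^ n) * (ρ.mat * basisProj (U 0) b).trace := by
      rw [← Finset.mul_sum, hρ, mul_one]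
    rw [hconst, ← Finset.sum_sub_distrib]
    refine Finset.sum_congr rfl fun b _ => ?_
    rw [mubProtocol_law_zero, mubProtocol_evol_diag, trace_snapshot_mubProtocol_zero hU b hO]
    field_simp
  have hs : ∀ i : Fin (2 ^ n), ∑ b,
      (((mubProtocol n U).law (i.succ : Fin (2 ^ n + 1))).toReal : ℂ) *
      (mubProtocol n U).evol (i.succ : Fin (2 ^ n + 1)) ρ.mat b b *
      ((mubProtocol n U).snapshot ((i.succ : Fin (2 ^ n + 1)), b) * O).trace
      = ∑ b, (ρ.mat * basisProj (U i.succ) b).trace * (O * basisProj (U i.succ) b).trace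
        - (2 * 2 ^ n - 1) / (2 * 2 ^ n * 2 ^ n) := by
    intro i
    have hconst : (2 * 2 ^ n - 1 : ℂ) / (2 * 2 ^ n * 2 ^ n) = ∑ b,
        (2 * 2 ^ n - 1) / (2 * 2 ^ n * 2 ^ n) * (ρ.mat * basisProj (U i.succ) b).trace := by
      rw [← Finset.mul_sum, hρ, mul_one]
    rw [hconst, ← Finset.sum_sub_distrib]
    refine Finset.sum_congr rfl fun b _ => ?_
    rw [mubProtocol_law_succ, mubProtocol_evol_diag,
      trace_snapshot_mubProtocol_of_ne_zero hU (Fin.succ_ne_zero i) b hO]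
    field_simp
  have h2 := hU.sum_trace_mul_trace ρ.mat O
  rw [Fin.sum_univ_succ, hO, ρ.trace_eq_one, one_mul] at h2
  refine (Fin.sum_univ_succ (n := 2 ^ n) _).trans ?_
  rw [h0]
  simp only [hs]
  rw [Finset.sum_sub_distrib, Finset.sum_const, Finset.card_univ, Fintype.card_fin, nsmul_eq_mul]
  push_cast
  have h3 : (1 : ℂ) / (2 * 2 ^ n) + 2 ^ n * ((2 * 2 ^ n - 1) / (2 * 2 ^ n * 2 ^ n)) = 1 := by
    field_simp
    ring
  linear_combination h2 - h3

/-- Every single-shot estimate lies in `[-4, 4]`. -/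
theorem mubProtocol_second_moment
    {U : Fin (2 ^ n + 1) → unitary (Matrix (Qubits n) (Qubits n) ℂ)} (hU : IsCompleteMUB n U)
    (ρ : DensityMatrix (Qubits n)) {c : ℂ} (hc : c * star c = 1) {j k : Qubits n} (hjk : j ≠ k) :
    ∑ r, ((mubProtocol n U).shot ρ r).toReal *
      ((mubProtocol n U).snapshot r * ketBra (pairKet c j k)).trace.re ^ 2 ≤ 16 := by
  set O := ketBra (pairKet c j k) with hOdef
  have hO : O.trace = 1 := trace_ketBra_pairKet hc hjk
  have hOs : O.conjTranspose = O := star_ketBra _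
  have hO2 : O * O = O := ketBra_pairKet_mul_self hc hjk
  have hcn : ‖c‖ = 1 := by
    refine (pow_eq_one_iff_of_nonneg (norm_nonneg c) two_ne_zero).1 ?_
    rw [sq, ← CStarRing.norm_self_mul_star, hc, norm_one]
  have hd : (1 : ℝ) ≤ 2 ^ n := one_le_pow₀ (by norm_num)
  have hd1 : 1 / (2 : ℝ) ^ n ≤ 1 := by rw [div_le_one (by positivity)]; exact hd
  have hd0 : 0 ≤ 1 / (2 : ℝ) ^ n := by positivity
  have hpsd : ∀ i b, (basisProj (U i) b).PosSemidef := fun i b =>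
    Matrix.posSemidef_vecMulVec_self_star _
  have ht : ∀ r, ((mubProtocol n U).snapshot r * O).trace.re ^ 2 ≤ 16 := by
    rintro ⟨i, b⟩
    change Fin (2 ^ n + 1) at i
    have hq0 := trace_mul_nonneg_of_projection (hpsd i b) hOs hO2
    have hq1 := trace_mul_le_of_projection (hpsd i b) hOs hO2
    rw [trace_basisProj] at hq1
    set q := (basisProj (U i) b * O).trace.re with hq
    have hqc : (O * basisProj (U i) b).trace = (q : ℂ) := by
      rw [Matrix.trace_mul_comm]
      exact eq_ofReal_re_of_nonneg hq0
    have hq0' : 0 ≤ q := (Complex.le_def.1 hq0).1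
    have hq1' : q ≤ 1 := (Complex.le_def.1 hq1).1
    by_cases hi : i = 0
    · subst hi
      have : ((mubProtocol n U).snapshot ((0 : Fin (2 ^ n + 1)), b) * O).trace
          = ((2 * q - 1 / 2 ^ n : ℝ) : ℂ) := by
        rw [trace_snapshot_mubProtocol_zero hU b hO, hqc]
        push_cast
        ring
      rw [this, Complex.ofReal_re]
      nlinarith
    · have : ((mubProtocol n U).snapshot ((i : Fin (2 ^ n + 1)), b) * O).trace
          = ((2 * (2 ^ n * q) - (2 - 1 / 2 ^ n) : ℝ) : ℂ) := by
        rw [trace_snapshot_mubProtocol_of_ne_zero hU hi b hO, hqc]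
        push_cast
        field_simp
      rw [this, Complex.ofReal_re]
      have hw : ∀ l, ‖(star (U i : Matrix (Qubits n) (Qubits n) ℂ)).mulVec (ket b) l‖ ^ 2
          = 1 / 2 ^ n := by
        intro l
        have h := hU.2 0 i (Ne.symm hi) l b
        rwa [hU.1, OneMemClass.coe_one, star_one, Matrix.one_mulVec, ket, Pi.star_single, star_one,
          single_dotProduct, one_mul] at h
      have hq2 : q ≤ 2 * (1 / 2 ^ n) :=
        trace_ketBra_mul_ketBra_pairKet_re_le hcn j k _ (hw j) (hw k)
      have hq3 : 2 ^ n * q ≤ 2 := by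
        calc (2 : ℝ) ^ n * q ≤ 2 ^ n * (2 * (1 / 2 ^ n)) := by gcongr
          _ = 2 := by field_simp
      have hq4 : 0 ≤ 2 ^ n * q := by positivity
      nlinarith
  calc _ ≤ ∑ r, ((mubProtocol n U).shot ρ r).toReal * 16 :=
        Finset.sum_le_sum fun r _ => mul_le_mul_of_nonneg_left (ht r) ENNReal.toReal_nonneg
    _ = 16 := by rw [← Finset.sum_mul, sum_toReal_eq_one, one_mul]

/-- Both shadow protocols give unbiased estimates of the projectors `|φ_jk⟩⟨φ_jk|` and
`|ψ_jk⟩⟨ψ_jk|`, with second moments bounded independently of the dimension. -/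
theorem IsCliffordOrBiasedMUB.moments {S : ShadowProtocol (Qubits n)}
    (hS : IsCliffordOrBiasedMUB n S) (ρ : DensityMatrix (Qubits n)) {c : ℂ} (hc : c * star c = 1)
    {j k : Qubits n} (hjk : j ≠ k) :
    (∑ r, (S.shot ρ r).toReal * (S.snapshot r * ketBra (pairKet c j k)).trace.re
      = (ρ.mat * ketBra (pairKet c j k)).trace.re) ∧
    ∑ r, (S.shot ρ r).toReal * (S.snapshot r * ketBra (pairKet c j k)).trace.re ^ 2 ≤ 16 := by
  have hO := trace_ketBra_pairKet hc hjk
  rcases hS with rfl | ⟨U, hU, rfl⟩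
  · exact ⟨cliffordProtocol_mean ρ hO, cliffordProtocol_second_moment ρ hO (star_ketBra _)
      (ketBra_pairKet_mul_self hc hjk)⟩
  · exact ⟨mubProtocol_mean hU ρ hO, mubProtocol_second_moment hU ρ hc hjk⟩

/-! ### Reconstruction of off-diagonal entries -/

theorem recombine_projectors {ι : Type} [Fintype ι] [DecidableEq ι] (A : Matrix ι ι ℂ) (j k : ι) :
    recombine (A * ketBra (phiKet j k)).trace (A * ketBra (psiKet j k)).trace (A j j) (A k k)
      = A j k := by
  rw [phiKet_eq_pairKet, psiKet_eq_pairKet, trace_mul_ketBra_pairKet, trace_mul_ketBra_pairKet,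
    recombine]
  simp only [star_one, RCLike.star_def, Complex.conj_I]
  linear_combination (-(A j k) / 2 + A k j / 2 + Complex.I / 2 * A k k) * Complex.I_mul_I

/-- Errors of size `ε` in the four inputs change the recombined entry by at most `4 ε`. -/
theorem norm_recombine_sub_le {φ ψ p q φ' ψ' p' q' : ℂ} {ε : ℝ} (hφ : ‖φ - φ'‖ ≤ ε)
    (hψ : ‖ψ - ψ'‖ ≤ ε) (hp : ‖p - p'‖ ≤ ε) (hq : ‖q - q'‖ ≤ ε) :
    ‖recombine φ ψ p q - recombine φ' ψ' p' q'‖ ≤ 4 * ε := by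
  have hc : ‖(1 - Complex.I) / 2‖ ≤ 1 := by
    rw [norm_div, Complex.norm_two, div_le_one (by norm_num)]
    refine (norm_sub_le _ _).trans ?_
    rw [norm_one, Complex.norm_I]
    norm_num
  have h : recombine φ ψ p q - recombine φ' ψ' p' q' = (φ - φ') - Complex.I * (ψ - ψ')
      - (1 - Complex.I) / 2 * ((p - p') + (q - q')) := by
    simp only [recombine]
    ring
  rw [h]
  calc _ ≤ ‖φ - φ'‖ + ‖Complex.I * (ψ - ψ')‖ + ‖(1 - Complex.I) / 2 * ((p - p') + (q - q'))‖ :=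
        (norm_sub_le _ _).trans (by gcongr; exact norm_sub_le _ _)
    _ ≤ ε + ε + 1 * (ε + ε) := by
        rw [norm_mul, norm_mul, Complex.norm_I, one_mul]
        have : ‖(p - p') + (q - q')‖ ≤ ε + ε := (norm_add_le _ _).trans (add_le_add hp hq)
        gcongr
    _ = 4 * ε := by ring

/-! ### Simultaneous accuracy of the estimates -/

/-- The failure probability is `δ / 2`, so that the diagonal and the shadow estimates may both be
required with total failure probability `δ`. -/
theorem relFreq_diag_accurate (ρ : DensityMatrix (Qubits n)) {K : ℕ} (hK : 0 < K)
    (j k : Fin K → Qubits n) {ε δ : ℝ} (hε : 0 < ε) (hδ : 0 < δ) (hδ1 : δ < 1) {N : ℕ}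
    (hN : 4096 * Real.log (2 * K / δ) / ε ^ 2 ≤ N) :
    (iidPMF ρ.measure N).toOuterMeasure
      {x | ∀ t, ‖(relFreq x (j t) : ℂ) - ρ.mat (j t) (j t)‖ ≤ ε ∧
        ‖(relFreq x (k t) : ℂ) - ρ.mat (k t) (k t)‖ ≤ ε}ᶜ ≤ ENNReal.ofReal (δ / 2) := by
  have hnorm : ∀ (x : Fin N → Qubits n) (i : Qubits n), ‖(relFreq x i : ℂ) - ρ.mat i i‖
      = |relFreq x i - (ρ.measure i).toReal| := by
    intro x i
    rw [ρ.diag_eq_ofReal i, ← Complex.ofReal_sub, Complex.norm_real, Real.norm_eq_abs,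
      ρ.measure_apply_toReal]
  refine le_trans (MeasureTheory.measure_mono fun x hx => ?_)
    (relFreq_sample_complexity ρ.measure (Sum.elim j k) hK (by simp; omega) hε hδ hδ1 hN)
  simp only [Set.mem_compl_iff, Set.mem_ofPred_eq, hnorm, not_forall] at hx
  obtain ⟨t, ht⟩ := hx
  by_cases h : |relFreq x (j t) - (ρ.measure (j t)).toReal| ≤ ε
  · exact ⟨Sum.inr t, not_le.1 fun h' => ht ⟨h, h'⟩⟩
  · exact ⟨Sum.inl t, not_le.1 h⟩

theorem IsCliffordOrBiasedMUB.estimate_accurate {S : ShadowProtocol (Qubits n)}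
    (hS : IsCliffordOrBiasedMUB n S) (ρ : DensityMatrix (Qubits n)) {K : ℕ} (hK : 0 < K)
    {j k : Fin K → Qubits n} (hjk : ∀ t, j t ≠ k t) {ε δ : ℝ} (hε : 0 < ε) (hδ : 0 < δ)
    (hδ1 : δ < 1) {N : ℕ} (hN : 4096 * Real.log (2 * K / δ) / ε ^ 2 ≤ N) :
    (iidPMF (S.shot ρ) N).toOuterMeasure
      {r | ∀ t,
        ‖(S.estimate ⌈2 * Real.log (2 * K / δ)⌉₊ r (ketBra (phiKet (j t) (k t))) : ℂ)
          - (ρ.mat * ketBra (phiKet (j t) (k t))).trace‖ ≤ ε ∧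
        ‖(S.estimate ⌈2 * Real.log (2 * K / δ)⌉₊ r (ketBra (psiKet (j t) (k t))) : ℂ)
          - (ρ.mat * ketBra (psiKet (j t) (k t))).trace‖ ≤ ε}ᶜ ≤ ENNReal.ofReal (δ / 2) := by
  simp only [phiKet_eq_pairKet, psiKet_eq_pairKet]
  let O : Fin K ⊕ Fin K → Matrix (Qubits n) (Qubits n) ℂ := Sum.elim
    (fun t => ketBra (pairKet 1 (j t) (k t))) (fun t => ketBra (pairKet Complex.I (j t) (k t)))
  have h1 : (1 : ℂ) * star 1 = 1 := by simp
  have hI : Complex.I * star Complex.I = 1 := by simp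
  have hO : ∀ t, (O t).conjTranspose = O t ∧ O t * O t = O t := by
    rintro (t | t)
    · exact ⟨star_ketBra _, ketBra_pairKet_mul_self h1 (hjk t)⟩
    · exact ⟨star_ketBra _, ketBra_pairKet_mul_self hI (hjk t)⟩
  have hmom : ∀ t, (∑ r, (S.shot ρ r).toReal * (S.snapshot r * O t).trace.re
      = (ρ.mat * O t).trace.re) ∧
      ∑ r, (S.shot ρ r).toReal * (S.snapshot r * O t).trace.re ^ 2 ≤ 16 := by
    rintro (t | t)
    · exact hS.moments ρ h1 (hjk t)
    · exact hS.moments ρ hI (hjk t)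
  have hnorm : ∀ (y : ℝ) t, ‖(y : ℂ) - (ρ.mat * O t).trace‖ = |y - (ρ.mat * O t).trace.re| := by
    intro y t
    rw [(ρ.re_trace_mul_mem (hO t).1 (hO t).2).1, ← Complex.ofReal_sub, Complex.norm_real,
      Real.norm_eq_abs, Complex.ofReal_re]
  refine le_trans (MeasureTheory.measure_mono fun r hr => ?_)
    (medianOfMeans_sample_complexity (S.shot ρ) (fun t r => (S.snapshot r * O t).trace.re)
      (fun t => (ρ.mat * O t).trace.re) (fun t => (hmom t).1) (fun t => ?_) (fun t => (hmom t).2)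
      hK (by simp; omega) hε hδ hδ1 hN)
  · simp only [Set.mem_compl_iff, Set.mem_ofPred_eq, not_forall] at hr
    obtain ⟨t, ht⟩ := hr
    have hφ := hnorm (S.estimate ⌈2 * Real.log (2 * K / δ)⌉₊ r (O (Sum.inl t))) (Sum.inl t)
    have hψ := hnorm (S.estimate ⌈2 * Real.log (2 * K / δ)⌉₊ r (O (Sum.inr t))) (Sum.inr t)
    change ∃ t, ε < |S.estimate ⌈2 * Real.log (2 * K / δ)⌉₊ r (O t) - (ρ.mat * O t).trace.re|
    by_contra! hall
    exact ht ⟨hφ.trans_le (hall _), hψ.trans_le (hall _)⟩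
  · obtain ⟨-, h0, h1⟩ := ρ.re_trace_mul_mem (hO t).1 (hO t).2
    rwa [abs_of_nonneg h0]

end Shadows

theorem theorem2 :
    -- universal constants: they depend on nothing, in particular not on the dimension `2 ^ n`
    ∃ C c : ℝ, 0 < C ∧ 0 < c ∧
      ∀ (n K : ℕ) (_hK : 0 < K) (j k : Fin K → Qubits n)
        (_hdistinct : Function.Injective fun t => (j t, k t)) (_hoff : ∀ t, j t ≠ k t)
        (ε δ : ℝ) (_hε : 0 < ε) (_hδ : 0 < δ) (_hδ1 : δ < 1) (ρ : DensityMatrix (Qubits n)),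
        -- each entry is recovered from its two diagonal entries and the two projectors
        (∀ t, ρ.mat (j t) (k t) =
          recombine (ρ.mat * ketBra (phiKet (j t) (k t))).trace
            (ρ.mat * ketBra (psiKet (j t) (k t))).trace
            (ρ.mat (j t) (j t)) (ρ.mat (k t) (k t))) ∧
        -- the diagonal entries, by relative frequencies in the computational basis
        (∀ N : ℕ, C * Real.log (2 * K / δ) / ε ^ 2 ≤ N →
          ENNReal.ofReal (1 - δ) ≤ (iidPMF ρ.measure N).toOuterMeasure
            {x | ∀ t, ‖(relFreq x (j t) : ℂ) - ρ.mat (j t) (j t)‖ ≤ ε ∧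
              ‖(relFreq x (k t) : ℂ) - ρ.mat (k t) (k t)‖ ≤ ε}) ∧
        ∀ S : ShadowProtocol (Qubits n), IsCliffordOrBiasedMUB n S →
          -- the projector expectations, by classical shadows
          (∀ N : ℕ, C * Real.log (2 * K / δ) / ε ^ 2 ≤ N →
            ENNReal.ofReal (1 - δ) ≤ (iidPMF (S.shot ρ) N).toOuterMeasure
              {r | ∀ t,
                ‖(S.estimate ⌈c * Real.log (2 * K / δ)⌉₊ r
                    (ketBra (phiKet (j t) (k t))) : ℂ)
                  - (ρ.mat * ketBra (phiKet (j t) (k t))).trace‖ ≤ ε ∧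
                ‖(S.estimate ⌈c * Real.log (2 * K / δ)⌉₊ r
                    (ketBra (psiKet (j t) (k t))) : ℂ)
                  - (ρ.mat * ketBra (psiKet (j t) (k t))).trace‖ ≤ ε}) ∧
          -- the off-diagonal entries, by recombining the estimates of the two steps
          (∀ N₁ N₂ : ℕ, C * Real.log (2 * K / δ) / ε ^ 2 ≤ N₁ →
            C * Real.log (2 * K / δ) / ε ^ 2 ≤ N₂ →
            ENNReal.ofReal (1 - δ) ≤
              (prodPMF (iidPMF ρ.measure N₁) (iidPMF (S.shot ρ) N₂)).toOuterMeasure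
                {w | ∀ t,
                  ‖recombine
                      (S.estimate ⌈c * Real.log (2 * K / δ)⌉₊ w.2
                        (ketBra (phiKet (j t) (k t))))
                      (S.estimate ⌈c * Real.log (2 * K / δ)⌉₊ w.2
                        (ketBra (psiKet (j t) (k t))))
                      (relFreq w.1 (j t)) (relFreq w.1 (k t))
                    - ρ.mat (j t) (k t)‖ ≤ ε}) := by
  refine ⟨65536, 2, by norm_num, by norm_num, ?_⟩
  intro n K hK j k _ hoff ε δ hε hδ hδ1 ρ
  have hδ2 : ENNReal.ofReal (δ / 2) ≤ ENNReal.ofReal δ := ENNReal.ofReal_le_ofReal (by linarith)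
  have hL : 0 ≤ Real.log (2 * K / δ) := by linarith [log_two_le_log_div hK hδ hδ1]
  have hfull : ∀ N : ℕ, 65536 * Real.log (2 * K / δ) / ε ^ 2 ≤ N →
      4096 * Real.log (2 * K / δ) / ε ^ 2 ≤ N := fun N hN => le_trans (by gcongr; norm_num) hN
  -- The recombination multiplies the error by at most four.
  have hquarter : ∀ N : ℕ, 65536 * Real.log (2 * K / δ) / ε ^ 2 ≤ N →
      4096 * Real.log (2 * K / δ) / (ε / 4) ^ 2 ≤ N := fun N hN =>
    le_trans (le_of_eq (by field_simp; ring)) hN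
  refine ⟨fun t => (recombine_projectors _ _ _).symm, fun N hN => ?_, fun S hS =>
    ⟨fun N hN => ?_, fun N₁ N₂ hN₁ hN₂ => ?_⟩⟩
  · exact ofReal_one_sub_le_toOuterMeasure _ hδ.le
      ((relFreq_diag_accurate ρ hK j k hε hδ hδ1 (hfull N hN)).trans hδ2)
  · exact ofReal_one_sub_le_toOuterMeasure _ hδ.le
      ((hS.estimate_accurate ρ hK hoff hε hδ hδ1 (hfull N hN)).trans hδ2)
  · have hε4 : 0 < ε / 4 := by positivity
    have h1 := relFreq_diag_accurate ρ hK j k hε4 hδ hδ1 (hquarter N₁ hN₁)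
    have h2 := hS.estimate_accurate ρ hK hoff hε4 hδ hδ1 (hquarter N₂ hN₂)
    refine ofReal_one_sub_le_toOuterMeasure _ hδ.le (le_trans ?_
      (((prodPMF_toOuterMeasure_compl_le _ _ _ _).trans (add_le_add h1 h2)).trans_eq ?_))
    · refine MeasureTheory.measure_mono (Set.compl_subset_compl.2 ?_)
      rintro w ⟨hw1, hw2⟩ t
      have h := norm_recombine_sub_le (hw2 t).1 (hw2 t).2 (hw1 t).1 (hw1 t).2
      rw [recombine_projectors] at h
      exact h.trans_eq (by ring)
    · rw [← ENNReal.ofReal_add (by positivity) (by positivity), add_halves]
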